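/- Let $p$ be a prime and let $K$ be a complete ultrametric valued field of mixed characteristic $(0,p)$. Let $X=\mathrm D^+(c_0,R_0)-\bigcup_{i=1}^m\mathrm D^-(c_i,R_i)$ be a $K$-affinoid, where $R_0,\dots,R_m>0$, $c_0\in K$ and $c_1,\dots,c_m\in K$ satisfy $|c_i-c_0|\le R_0$, and put $r_X=\min(R_0,\dots,R_m)$. Let $L$ be a complete algebraically closed valued extension of $K$; write $x\in X$ for $x\in X(L)$ and $\|f\|_X=\sup_{x\in X}|f(x)|$ (for a matrix, the maximum over its entries). Let $\mathcal H_K(X)$ be the completion, with respect to $\|\cdot\|_X$, of the ring of rational fractions in $K(T)$ without poles in $X$. Let $q\in K$ be such that $|q-1|<1$ and $x\mapsto qx$ is a bijection of $X$ (i.e. $q\in\mathcal Q_1(X)$), and assume that $q$ is not a root of unity. Let $A(T)\in GL_n(\mathcal H_K(X))$ and consider the $q$-difference equation $Y(qT)=A(T)Y(T)$. With $\sigma_q(f)(T)=f(qT)$ and $d_q=\frac{\sigma_q-1}{(q-1)T}$, let $H_k$ be the matrix with $d_q^k(Y)=H_kY$, that is $H_0=1$ and $(q-1)T\,H_{k+1}(T)=H_k(qT)A(T)-H_k(T)$.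 The generic $q$-Taylor solution is $$Y_A(x,y)=\sum_{k\ge0}H_k(y)\frac{(x-y)_{q,k}}{[k]_q^!},\quad (x-y)_{q,k}=\prod_{i=0}^{k-1}(x-q^iy),\quad [k]_q^!=\frac{(q-1)(q^2-1)\cdots(q^k-1)}{(q-1)^k}.$$ Assume that the equation is Taylor admissible, with radius $R$: all $H_k$ belong to $M_n(\mathcal H_K(X))$, $$|q-1|\max(|c_0|,R_0)<R\le r_X,$$ and $Y_A(x,y)$ converges as an analytic function on $\mathcal U_R=\{(x,y)\in X\times X : |x-y|<R\}$, i.e. $\liminf_k(\|H_k\|_X/|[k]_q^!|)^{-1/k}\ge R$. Put $\mathrm D=\mathrm D^-\bigl(1,R/\max(|c_0|,R_0)\bigr)$. Then the series $Y_A(x,y)$ converges for all $(x,y)\in\mathcal U_R$, and there exists a matrix $A(Q,T)$ with the following properties. 1. $A(Q,T)$ is analytic over $K$ and invertible, with analytic inverse, on $\mathrm D\times X$. 2. $A(q,T)=A(T)$. 3. For all $q'\in\mathrm D$ and all $(T,y)\in\mathcal U_R$ one has $Y_A(q'T,y)=A(q',T)\,Y_A(T,y)$. Moreover $A(Q,T)=Y_A(QT,T)$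 on $\mathrm D\times X$. The matrix is uniquely determined by these properties: every analytic matrix on $\mathrm D\times X$ satisfying (3) for all $q'\in\mathrm D\cap K$ is equal to $A(Q,T)$. It is also independent of the choice of the solution: let $Z(x,y)$ be any matrix function on $\mathcal U_R$ such that, for every $y\in X$, $x\mapsto Z(x,y)$ is an analytic, everywhere invertible matrix on $\mathrm D^-(y,R)$ with $Z(qx,y)=A(x)Z(x,y)$. Then $Z(q'T,y)=A(q',T)Z(T,y)$ for all $q'\in\mathrm D$ and $(T,y)\in\mathcal U_R$, and $A(Q,T)$ is the only analytic matrix on $\mathrm D\times X$ for which this holds for all $q'\in\mathrm D\cap K$. -/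

import Mathlib

open Filter Topology Polynomial
open scoped ENNReal

namespace QDiff

/-- The data `c₀, …, cₘ ∈ K`, `R₀, …, Rₘ > 0`, with `c₁, …, cₘ ∈ D⁺(c₀, R₀)`, of the `K`-affinoid
`X = D⁺(c₀, R₀) - ⋃_{i = 1, …, m} D⁻(cᵢ, Rᵢ)`. -/
structure Affinoid (K : Type*) [NormedField K] where
  m : ℕ
  c : Fin (m + 1) → K
  R : Fin (m + 1) → ℝ
  R_pos : ∀ i, 0 < R i
  c_mem : ∀ i, ‖c i - c 0‖ ≤ R 0

section

variable {K : Type*} [NormedField K] {L : Type*} [NormedField L] [NormedAlgebra K L] {n : ℕ}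

/-- `X(L)`, the set of `L`-rational points of `X`, for a valued extension `L` of `K`. -/
def Affinoid.points (X : Affinoid K) (L : Type*) [NormedField L] [NormedAlgebra K L] : Set L :=
  {x | ‖x - algebraMap K L (X.c 0)‖ ≤ X.R 0 ∧
    ∀ i : Fin X.m, X.R i.succ ≤ ‖x - algebraMap K L (X.c i.succ)‖}

/-- `r_X = min(R₀, …, Rₘ)`. -/
noncomputable def Affinoid.minRadius (X : Affinoid K) : ℝ :=
  Finset.univ.inf' Finset.univ_nonempty X.R

/-- `max(|c₀|, R₀)`. -/
noncomputable def Affinoid.size (X : Affinoid K) : ℝ := max ‖X.c 0‖ (X.R 0)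

/-- `f ∈ ℋ_K(X)`: on `X(L)` the function `f` is a uniform limit of rational fractions `P / Q` in
`K(T)` without poles in `X`. Only the values of `f` on `X(L)` matter. The field `L` will be complete
and algebraically closed. -/
def IsAnalyticElement (X : Affinoid K) (f : L → L) : Prop :=
  ∀ ε : ℝ, 0 < ε → ∃ P Q : K[X], (∀ x ∈ X.points L, aeval x Q ≠ 0) ∧
    ∀ x ∈ X.points L, ‖f x - aeval x P / aeval x Q‖ ≤ ε

/-- `A ∈ M_n(ℋ_K(X))`. -/
def IsAnalyticMatrix (X : Affinoid K) (A : L → Matrix (Fin n) (Fin n) L) : Prop :=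
  ∀ i j, IsAnalyticElement X fun x => A x i j

/-- `A ∈ GL_n(ℋ_K(X))`. -/
def IsAnalyticGL (X : Affinoid K) (A : L → Matrix (Fin n) (Fin n) L) : Prop :=
  IsAnalyticMatrix X A ∧ ∃ B : L → Matrix (Fin n) (Fin n) L, IsAnalyticMatrix X B ∧
    ∀ x ∈ X.points L, A x * B x = 1 ∧ B x * A x = 1

/-- `‖f‖_X`, the supremum of `|f|` on `X(L)`. -/
noncomputable def affinoidNorm (X : Affinoid K) (f : L → L) : ℝ≥0∞ :=
  ⨆ x ∈ X.points L, ‖f x‖ₑ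

/-- `‖A‖_X`, the maximum of the norms of the entries. -/
noncomputable def affinoidMatrixNorm (X : Affinoid K) (A : L → Matrix (Fin n) (Fin n) L) : ℝ≥0∞ :=
  ⨆ (i : Fin n) (j : Fin n), affinoidNorm X fun x => A x i j

/-- `𝒬₁(X)`: the `q ∈ K` such that `x ↦ q x` is a bijection of `X` and `|q - 1| < 1`. -/
def Affinoid.Q₁ (X : Affinoid K) (L : Type*) [NormedField L] [NormedAlgebra K L] : Set K :=
  {q | Set.BijOn (fun x : L => algebraMap K L q * x) (X.points L) (X.points L) ∧ ‖q - 1‖ < 1}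

/-- `[n]_q^! = (q - 1)(q² - 1) ⋯ (qⁿ - 1) / (q - 1)ⁿ`. -/
noncomputable def qFactorial (q : K) (k : ℕ) : K :=
  (∏ i ∈ Finset.range k, (q ^ (i + 1) - 1)) / (q - 1) ^ k

/-- `(x - y)_{q,n} = (x - y)(x - q y) ⋯ (x - q^{n-1} y)`. -/
def qPow (q : K) (x y : L) (k : ℕ) : L :=
  ∏ i ∈ Finset.range k, (x - algebraMap K L q ^ i * y)

/-- `H k ∈ M_n(ℋ_K(X))` is the matrix of `d_q^k` for the equation `σ_q(Y) = A Y`, that is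
`d_q^k(Y) = H k · Y`, where `d_q = (σ_q - 1) / ((q - 1) T)`. As
`d_q(H k · Y) = (σ_q(H k) A - H k) / ((q - 1) T) · Y`, this says that `H 0 = 1` and
`(q - 1) T · H (k + 1) = σ_q(H k) A - H k`; the division by `T` has to be possible in `ℋ_K(X)`. -/
structure IsIteratedMatrix (X : Affinoid K) (q : K) (A : L → Matrix (Fin n) (Fin n) L)
    (H : ℕ → L → Matrix (Fin n) (Fin n) L) : Prop where
  analytic : ∀ k, IsAnalyticMatrix X (H k)
  zero : ∀ x ∈ X.points L, H 0 x = 1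
  succ : ∀ k, ∀ x ∈ X.points L,
    ((algebraMap K L q - 1) * x) • H (k + 1) x = H k (algebraMap K L q * x) * A x - H k x

/-- The term of index `k` of the generic `q`-Taylor solution. -/
noncomputable def taylorTerm (q : K) (H : ℕ → L → Matrix (Fin n) (Fin n) L) (x y : L) (k : ℕ) :
    Matrix (Fin n) (Fin n) L :=
  (qPow q x y k / algebraMap K L (qFactorial q k)) • H k y

/-- The generic `q`-Taylor solution `Y_A(x, y) = ∑ H_k(y) (x - y)_{q,k} / [k]_q^!`. -/
noncomputable def taylorSolution (q : K) (H : ℕ → L → Matrix (Fin n) (Fin n) L) (x y : L) :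
    Matrix (Fin n) (Fin n) L :=
  ∑' k, taylorTerm q H x y k

/-- `Ray(Y_A(x, y), X) = liminf_k (‖H_k‖_X / |[k]_q^!|)^{-1/k}`. -/
noncomputable def taylorRadius (X : Affinoid K) (q : K) (H : ℕ → L → Matrix (Fin n) (Fin n) L) :
    ℝ≥0∞ :=
  liminf (fun k : ℕ => (‖qFactorial q k‖ₑ / affinoidMatrixNorm X (H k)) ^ (1 / (k : ℝ))) atTop

/-- The equation `Y(qT) = A(T) Y(T)` is Taylor admissible, with radius `R`: the generic `q`-Taylor
solution `Y_A(x, y)`, with coefficients given by `H`, is an analytic function on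
`𝒰_R = {(x, y) ∈ X × X : |x - y| < R}`, and `|q - 1| max(|c₀|, R₀) < R ≤ r_X`. -/
structure IsTaylorAdmissible (X : Affinoid K) (q : K) (A : L → Matrix (Fin n) (Fin n) L)
    (H : ℕ → L → Matrix (Fin n) (Fin n) L) (R : ℝ) : Prop where
  iterated : IsIteratedMatrix X q A H
  lt_radius : ‖q - 1‖ * X.size < R
  radius_le : R ≤ X.minRadius
  le_taylorRadius : ENNReal.ofReal R ≤ taylorRadius X q H

/-- `F` is an analytic function (over `K`) of `(Q, T)` on `D⁻(1, ρ) × X`: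
`F(Q, T) = ∑ a_k(T) (Q - 1)^k` with `a_k ∈ ℋ_K(X)` and `‖a_k‖_X r^k → 0` for all `r < ρ`. -/
def IsAnalyticOnProd (X : Affinoid K) (ρ : ℝ) (F : L → L → L) : Prop :=
  ∃ a : ℕ → L → L, (∀ k, IsAnalyticElement X (a k)) ∧
    (∀ r : ℝ, 0 < r → r < ρ →
      Tendsto (fun k => affinoidNorm X (a k) * ENNReal.ofReal r ^ k) atTop (𝓝 0)) ∧
    ∀ Q T : L, ‖Q - 1‖ < ρ → T ∈ X.points L → HasSum (fun k => a k T * (Q - 1) ^ k) (F Q T)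

/-- A matrix of analytic functions on `D⁻(1, ρ) × X`. -/
def IsAnalyticMatrixOnProd (X : Affinoid K) (ρ : ℝ) (F : L → L → Matrix (Fin n) (Fin n) L) :
    Prop :=
  ∀ i j, IsAnalyticOnProd X ρ fun Q T => F Q T i j

/-- An analytic matrix on `D⁻(1, ρ) × X` with an analytic inverse. -/
def IsAnalyticGLOnProd (X : Affinoid K) (ρ : ℝ) (F : L → L → Matrix (Fin n) (Fin n) L) : Prop :=
  IsAnalyticMatrixOnProd X ρ F ∧ ∃ G : L → L → Matrix (Fin n) (Fin n) L,
    IsAnalyticMatrixOnProd X ρ G ∧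
      ∀ Q T : L, ‖Q - 1‖ < ρ → T ∈ X.points L → F Q T * G Q T = 1 ∧ G Q T * F Q T = 1

/-- `f` is an analytic function on the disk `D⁻(c, R)` over `L`. -/
def IsAnalyticOnDisk (c : L) (R : ℝ) (f : L → L) : Prop :=
  ∃ a : ℕ → L, ∀ x : L, ‖x - c‖ < R → HasSum (fun k => a k * (x - c) ^ k) (f x)

/-- `Z(x, y)` is a solution of `Y(qT) = A(T) Y(T)` on `𝒰_R`: for every `y ∈ X`, the function
`x ↦ Z(x, y)` is an invertible matrix of analytic functions on `D⁻(y, R)` that solves the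
equation. -/
def IsSolutionOn (X : Affinoid K) (q : K) (A : L → Matrix (Fin n) (Fin n) L) (R : ℝ)
    (Z : L → L → Matrix (Fin n) (Fin n) L) : Prop :=
  ∀ y ∈ X.points L, (∀ i j, IsAnalyticOnDisk y R fun x => Z x y i j) ∧
    ∀ x : L, ‖x - y‖ < R → IsUnit (Z x y) ∧ Z (algebraMap K L q * x) y = A x * Z x y

/-- `Z(Q T, y) = F(Q, T) Z(T, y)` for all `(T, y) ∈ 𝒰_R`. -/
def SatisfiesAt (X : Affinoid K) (R : ℝ) (Z F : L → L → Matrix (Fin n) (Fin n) L) (Q : L) : Prop :=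
  ∀ T ∈ X.points L, ∀ y ∈ X.points L, ‖T - y‖ < R → Z (Q * T) y = F Q T * Z T y

end

end QDiff

/-! Take F(Q,T) = Y_A(QT,T). The engine is an identity principle: since |q - 1| < 1 and |p| < 1, the
powers q^{p^m} tend to 1, and they never equal 1 because q is not a root of unity. For T ≠ 0 the
points q^{p^m}T therefore accumulate at T without reaching it, and an analytic function on a disk
around T that vanishes at all of them is zero (`eq_zero_of_tendsto_of_mem_analyticOnDisk`).

At x = q^i y the series Y_A(x,y) is a finite sum equal to A(q^{i-1}y)⋯A(y)
(`taylorSolution_pow_mul_self`). Any solution Z on D⁻(T,R) satisfies Z(q^i T) =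
A(q^{i-1}T)⋯A(T)Z(T), so Z(x) = Y_A(x,T)Z(T) on the whole disk (`IsTaylorAdmissible.solution_mul`).
At x = QT this gives Z(QT) = F(Q,T)Z(T). It applies to Y_A(·,y) once Y_A is known to solve the
equation, which follows from the same principle for y ≠ 0 and by analyticity in y at y = 0.

Analyticity of F comes from uniform convergence of partial sums that are polynomials in Q - 1 over
ℋ_K(X). For the inverse, Y_A(QT,T)Y_A(T,QT) = 1 bounds det F from below on smaller disks; over an
algebraically closed field a power series bounded below has a dominant constant term, and its formal
inverse then has the same coefficient bounds (`IsAnalyticFamily.inv`). Uniqueness is the identity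
principle in Q, since the q^{p^m} lie in K. -/

namespace QDiff

/-! ### Coefficient estimates for ultrametric power series. -/

section PowerSeriesBounds

section

variable {L : Type*} [NormedField L]

theorem norm_mul_pow_le_mul_pow {a : ℕ → L} {r r' C : ℝ} (hr' : 0 < r')
    (ha : ∀ k, ‖a k‖ * r' ^ k ≤ C) {t : L} (ht : ‖t‖ ≤ r) (k : ℕ) :
    ‖a k * t ^ k‖ ≤ C * (r / r') ^ k := by
  rw [norm_mul, norm_pow]
  calc ‖a k‖ * ‖t‖ ^ k ≤ ‖a k‖ * r ^ k := by gcongr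
    _ = ‖a k‖ * r' ^ k * (r / r') ^ k := by
      rw [mul_assoc, ← mul_pow, mul_div_cancel₀ _ hr'.ne']
    _ ≤ _ := by
      have : 0 ≤ r := (norm_nonneg t).trans ht
      gcongr
      exact ha k

theorem summable_norm_mul_pow {a : ℕ → L} {r C : ℝ} (hr : 0 < r)
    (ha : ∀ k, ‖a k‖ * r ^ k ≤ C) {t : L} (ht : ‖t‖ < r) :
    Summable fun k => ‖a k * t ^ k‖ := by
  refine Summable.of_nonneg_of_le (fun _ => norm_nonneg _)
    (fun k => norm_mul_pow_le_mul_pow hr ha le_rfl k) ?_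
  exact (summable_geometric_of_lt_one (by positivity) ((div_lt_one hr).2 ht)).mul_left C

/-- Roots of an element of norm greater than 1 have norms arbitrarily close to 1, so the value group
is dense. -/
theorem exists_norm_mem_Ico [IsAlgClosed L] (hL : ∃ x : L, 1 < ‖x‖) {r R : ℝ} (hr : 0 < r)
    (hR : r < R) : ∃ t : L, r ≤ ‖t‖ ∧ ‖t‖ < R := by
  obtain ⟨x, hx⟩ := hL
  obtain ⟨n, hn⟩ := pow_unbounded_of_one_lt ‖x‖ ((one_lt_div hr).2 hR)
  have hn0 : n ≠ 0 := by
    rintro rfl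
    simp only [pow_zero] at hn
    exact absurd hn hx.le.not_gt
  obtain ⟨y, hy⟩ := IsAlgClosed.exists_pow_nat_eq x (Nat.pos_of_ne_zero hn0)
  have hyx : ‖y‖ ^ n = ‖x‖ := by rw [← norm_pow, hy]
  have hy1 : 1 < ‖y‖ := by
    by_contra! h
    exact absurd (hyx ▸ pow_le_one₀ (norm_nonneg y) h) hx.not_ge
  have hy2 : ‖y‖ < R / r := by
    by_contra! h
    have := pow_le_pow_left₀ (div_pos (hr.trans hR) hr).le h n
    linarith
  obtain ⟨m, hm1, hm2⟩ := exists_mem_Ico_zpow hr hy1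
  refine ⟨y ^ (m + 1), by rw [norm_zpow]; exact hm2.le, ?_⟩
  rw [norm_zpow, zpow_add_one₀ (zero_lt_one.trans hy1).ne']
  calc ‖y‖ ^ m * ‖y‖ ≤ r * ‖y‖ := by gcongr
    _ < r * (R / r) := by gcongr
    _ = R := mul_div_cancel₀ _ hr.ne'

end

variable {L : Type*} [NormedField L] [IsUltrametricDist L]

theorem norm_add_le_of_norm_le {x y : L} {C : ℝ} (hx : ‖x‖ ≤ C) (hy : ‖y‖ ≤ C) : ‖x + y‖ ≤ C :=
  (IsUltrametricDist.norm_add_le_max x y).trans (max_le hx hy)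

theorem norm_sub_le_of_norm_le {x y : L} {C : ℝ} (hx : ‖x‖ ≤ C) (hy : ‖y‖ ≤ C) : ‖x - y‖ ≤ C := by
  rw [sub_eq_add_neg]
  exact norm_add_le_of_norm_le hx (by rwa [norm_neg])

/-- Multiplying by X - a with |a| ≥ r preserves the dominance of the constant term at radius r. -/
theorem norm_coeff_multiset_prod_mul_pow_le {r : ℝ} (hr : 0 ≤ r) (s : Multiset L)
    (hs : ∀ a ∈ s, r ≤ ‖a‖) (k : ℕ) :
    ‖((s.map fun a => X - C a).prod).coeff k‖ * r ^ k ≤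
      ‖((s.map fun a => X - C a).prod).coeff 0‖ := by
  induction s using Multiset.induction_on generalizing k with
  | empty =>
    rcases k with _ | k
    · simp
    · simp [coeff_one]
  | cons a s ih =>
    have ih' := ih fun b hb => hs b (Multiset.mem_cons_of_mem hb)
    have ha := hs a (Multiset.mem_cons_self a s)
    set P := (s.map fun a => X - C a).prod
    rw [Multiset.map_cons, Multiset.prod_cons]
    rcases k with _ | k
    · simp
    · have h0 : ((X - C a) * P).coeff 0 = -a * P.coeff 0 := by
        simp [sub_mul, mul_coeff_zero]
      have h1 : ((X - C a) * P).coeff (k + 1) = P.coeff k - a * P.coeff (k + 1) := by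
        rw [sub_mul, coeff_sub, coeff_X_mul, coeff_C_mul]
      rw [h0, h1, norm_mul, norm_neg]
      have hrk : ‖(P.coeff k - a * P.coeff (k + 1))‖ ≤
          max ‖P.coeff k‖ ‖a * P.coeff (k + 1)‖ :=
        norm_sub_le_of_norm_le (le_max_left _ _) (le_max_right _ _)
      refine (mul_le_mul_of_nonneg_right hrk (by positivity)).trans ?_
      rw [max_mul_of_nonneg _ _ (by positivity)]
      refine max_le ?_ ?_
      · calc ‖P.coeff k‖ * r ^ (k + 1) = (‖P.coeff k‖ * r ^ k) * r := by ring
          _ ≤ ‖P.coeff 0‖ * ‖a‖ := mul_le_mul (ih' k) ha hr (norm_nonneg _)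
          _ = _ := mul_comm _ _
      · rw [norm_mul, mul_assoc]
        exact mul_le_mul_of_nonneg_left (ih' (k + 1)) (norm_nonneg _)

/-- A polynomial without zeros in a closed disk around `0` has a dominant constant term there. -/
theorem norm_coeff_mul_pow_le_of_eval_ne_zero [IsAlgClosed L] {P : L[X]} {r : ℝ} (hr : 0 ≤ r)
    (hP : ∀ t, ‖t‖ ≤ r → P.eval t ≠ 0) (k : ℕ) : ‖P.coeff k‖ * r ^ k ≤ ‖P.coeff 0‖ := by
  have hsp := (IsAlgClosed.splits P).eq_prod_roots
  rw [hsp, coeff_C_mul, coeff_C_mul, norm_mul, norm_mul, mul_assoc]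
  refine mul_le_mul_of_nonneg_left (norm_coeff_multiset_prod_mul_pow_le hr _ ?_ k) (norm_nonneg _)
  intro a ha
  by_contra! h
  exact hP a h.le (isRoot_of_mem_roots ha)

theorem norm_le_of_hasSum_of_forall_norm_le {f : ℕ → L} {s : L} {C : ℝ} (hs : HasSum f s)
    (hf : ∀ i, ‖f i‖ ≤ C) : ‖s‖ ≤ C := by
  rw [← hs.tsum_eq]
  exact IsUltrametricDist.norm_tsum_le_of_forall_le hf

/-- A power series bounded from below on a closed disk has a dominant constant term there. -/
theorem norm_coeff_mul_pow_le_of_le_norm [IsAlgClosed L] {a : ℕ → L} {f : L → L} {r r' C δ : ℝ}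
    (hr : 0 < r) (hrr' : r < r') (ha : ∀ k, ‖a k‖ * r' ^ k ≤ C)
    (hf : ∀ t, ‖t‖ ≤ r → HasSum (fun k => a k * t ^ k) (f t)) (hδ : 0 < δ)
    (hfδ : ∀ t, ‖t‖ ≤ r → δ ≤ ‖f t‖) (k : ℕ) : ‖a k‖ * r ^ k ≤ ‖a 0‖ := by
  have hr' : 0 < r' := hr.trans hrr'
  have hθ : r / r' < 1 := (div_lt_one hr').2 hrr'
  have hθ0 : 0 ≤ r / r' := by positivity
  have hC : 0 ≤ C := le_trans (by positivity) (ha 0)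
  have hlim : Tendsto (fun N => C * (r / r') ^ N) atTop (𝓝 0) := by
    simpa using (tendsto_pow_atTop_nhds_zero_of_lt_one hθ0 hθ).const_mul C
  -- N is large enough for the tail to stay below δ on the disk, so that the truncation cannot
  -- vanish there, and it exceeds k so that the truncation still sees `a k`.
  obtain ⟨N, hN, hkN⟩ := ((hlim.eventually_lt_const hδ).and (eventually_gt_atTop k)).exists
  set P : L[X] := ∑ i ∈ Finset.range N, Polynomial.C (a i) * X ^ i with hPdef
  have hcoeff : ∀ j < N, P.coeff j = a j := by
    intro j hj
    simp [hPdef, coeff_C_mul, coeff_X_pow, hj]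
  have heval : ∀ t, P.eval t = ∑ i ∈ Finset.range N, a i * t ^ i := by
    intro t
    simp [hPdef, eval_finsetSum]
  have hP : ∀ t, ‖t‖ ≤ r → P.eval t ≠ 0 := by
    intro t ht h0
    have h1 := (hasSum_nat_add_iff' N).2 (hf t ht)
    rw [← heval t, h0, sub_zero] at h1
    have h2 : ‖f t‖ ≤ C * (r / r') ^ N := by
      refine norm_le_of_hasSum_of_forall_norm_le h1 fun i => ?_
      refine (norm_mul_pow_le_mul_pow hr' ha ht (i + N)).trans ?_
      gcongr C * ?_
      exact pow_le_pow_of_le_one hθ0 hθ.le (Nat.le_add_left N i)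
    linarith [hfδ t ht]
  have := norm_coeff_mul_pow_le_of_eval_ne_zero hr.le hP k
  rwa [hcoeff k hkN, hcoeff 0 (by omega)] at this

/-- The Cauchy estimate on a closed disk. -/
theorem norm_coeff_mul_pow_le_of_norm_le [IsAlgClosed L] (hL : ∃ x : L, 1 < ‖x‖) {a : ℕ → L}
    {f : L → L} {r r' C ε : ℝ} (hr : 0 < r) (hrr' : r < r') (ha : ∀ k, ‖a k‖ * r' ^ k ≤ C)
    (hf : ∀ t, ‖t‖ ≤ r → HasSum (fun k => a k * t ^ k) (f t))
    (hfε : ∀ t, ‖t‖ ≤ r → ‖f t‖ ≤ ε) (k : ℕ) : ‖a k‖ * r ^ k ≤ ε := by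
  have ha0 : ‖a 0‖ ≤ ε := by
    have h1 := hf 0 (by simpa using hr.le)
    have h2 := h1.unique (hasSum_single 0 fun k hk => by simp [hk])
    simpa [h2] using hfε 0 (by simpa using hr.le)
  have hε : 0 ≤ ε := (norm_nonneg _).trans ha0
  rcases k with _ | k
  · simpa using ha0
  -- Add to f a constant c with ε < |c| < ε'. Then |f + c| ≥ |c| on the disk, so the constant term
  -- a₀ + c, of norm at most |c|, dominates all the others.
  refine le_of_forall_gt_imp_ge_of_dense fun ε' hε' => ?_
  obtain ⟨ε₁, hε₁, hε₁'⟩ := exists_between hε'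
  obtain ⟨c, hc, hc'⟩ := exists_norm_mem_Ico hL (hε.trans_lt hε₁) hε₁'
  have hc0 : ‖a 0 + c‖ ≤ ‖c‖ := norm_add_le_of_norm_le (ha0.trans (hε₁.le.trans hc)) le_rfl
  have key := norm_coeff_mul_pow_le_of_le_norm (a := fun k => a k + if k = 0 then c else 0)
    (f := fun t => f t + c) (C := max C ‖c‖) (δ := ‖c‖) hr hrr' ?_ ?_
    ((hε.trans_lt hε₁).trans_le hc) ?_ (k + 1)
  · simp only [Nat.succ_ne_zero, if_false, if_true, add_zero] at key
    exact key.trans (hc0.trans hc'.le)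
  · rintro (_ | j)
    · simpa using Or.inr hc0
    · simpa using Or.inl (ha (j + 1))
  · intro t ht
    have h1 : HasSum (fun k => (if k = 0 then c else 0) * t ^ k) c := by
      convert hasSum_single (f := fun k => (if k = 0 then c else 0) * t ^ k) 0
        (fun k hk => by simp [hk]) using 1
      simp
    simpa [add_mul] using (hf t ht).add h1
  · intro t ht
    by_contra! h
    have h1 : ‖f t‖ < ‖c‖ := ((hfε t ht).trans_lt hε₁).trans_le hc
    have h2 : ‖(f t + c) - f t‖ < ‖c‖ := by
      rw [sub_eq_add_neg]
      refine (IsUltrametricDist.norm_add_le_max _ _).trans_lt (max_lt h ?_)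
      rwa [norm_neg]
    simp at h2

theorem hasSum_antidiagonal_mul_pow [CompleteSpace L] {a b : ℕ → L} {r C C' : ℝ} (hr : 0 < r)
    (ha : ∀ k, ‖a k‖ * r ^ k ≤ C) (hb : ∀ k, ‖b k‖ * r ^ k ≤ C') {t x y : L} (ht : ‖t‖ < r)
    (hx : HasSum (fun k => a k * t ^ k) x) (hy : HasSum (fun k => b k * t ^ k) y) :
    HasSum (fun k => (∑ p ∈ Finset.HasAntidiagonal.antidiagonal k, a p.1 * b p.2) * t ^ k) (x * y) := by
  have h1 := summable_norm_mul_pow hr ha ht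
  have h2 := summable_norm_mul_pow hr hb ht
  have h3 := (summable_norm_sum_mul_antidiagonal_of_summable_norm h1 h2).of_norm.hasSum
  rw [← tsum_mul_tsum_eq_tsum_sum_antidiagonal_of_summable_norm h1 h2, hx.tsum_eq, hy.tsum_eq] at h3
  refine (congrArg (HasSum · _) (funext fun k => ?_)).mpr h3
  rw [Finset.sum_mul]
  refine Finset.sum_congr rfl fun p hp => ?_
  rw [← Finset.HasAntidiagonal.mem_antidiagonal.1 hp]
  ring

theorem norm_sum_antidiagonal_mul_pow_le {a b : ℕ → L} {r C C' : ℝ} (hr : 0 < r)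
    (ha : ∀ k, ‖a k‖ * r ^ k ≤ C) (hb : ∀ k, ‖b k‖ * r ^ k ≤ C') (k : ℕ) :
    ‖∑ p ∈ Finset.HasAntidiagonal.antidiagonal k, a p.1 * b p.2‖ * r ^ k ≤ C * C' := by
  have hC : 0 ≤ C := le_trans (by positivity) (ha 0)
  have hC' : 0 ≤ C' := le_trans (by positivity) (hb 0)
  rw [← le_div_iff₀ (by positivity)]
  refine IsUltrametricDist.norm_sum_le_of_forall_le_of_nonneg (by positivity) fun p hp => ?_
  rw [le_div_iff₀ (by positivity), ← Finset.HasAntidiagonal.mem_antidiagonal.1 hp, norm_mul, pow_add]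
  calc ‖a p.1‖ * ‖b p.2‖ * (r ^ p.1 * r ^ p.2) = (‖a p.1‖ * r ^ p.1) * (‖b p.2‖ * r ^ p.2) := by ring
    _ ≤ C * C' := mul_le_mul (ha _) (hb _) (by positivity) hC

end PowerSeriesBounds

/-! ### Power series in t with coefficients in a ring of functions of s. -/

section Family

variable {L : Type*} [NormedField L] {ι : Type*}

/-- `f(t, s)` is the sum of a power series in `t` on the open disk of radius `ρ` around `0`, with
coefficients in the ring of functions `𝒜`, and with convergence that is uniform in `s`. -/
def IsAnalyticFamily (𝒜 : Subring (ι → L)) (ρ : ℝ) (f : L → ι → L) : Prop :=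
  ∃ φ : PowerSeries 𝒜,
    (∀ r : ℝ, 0 < r → r < ρ → ∃ C : ℝ, ∀ k s,
      ‖((PowerSeries.coeff k φ : 𝒜) : ι → L) s‖ * r ^ k ≤ C) ∧
    ∀ t : L, ‖t‖ < ρ → ∀ s, HasSum (fun k => ((PowerSeries.coeff k φ : 𝒜) : ι → L) s * t ^ k) (f t s)

namespace IsAnalyticFamily

variable {𝒜 : Subring (ι → L)} {ρ : ℝ} {f g : L → ι → L}

theorem congr (hf : IsAnalyticFamily 𝒜 ρ f) (h : ∀ t, ‖t‖ < ρ → ∀ s, f t s = g t s) :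
    IsAnalyticFamily 𝒜 ρ g := by
  obtain ⟨φ, h1, h2⟩ := hf
  exact ⟨φ, h1, fun t ht s => h t ht s ▸ h2 t ht s⟩

theorem const {a : ι → L} (ha : a ∈ 𝒜) (hb : ∃ C, ∀ s, ‖a s‖ ≤ C) :
    IsAnalyticFamily 𝒜 ρ fun _ => a := by
  obtain ⟨C, hC⟩ := hb
  refine ⟨PowerSeries.C ⟨a, ha⟩, fun r hr _ => ⟨max C 0, fun k s => ?_⟩, fun t _ s => ?_⟩
  · rw [PowerSeries.coeff_C]
    split_ifs with h
    · simpa [h] using Or.inl (hC s)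
    · simp
  · convert hasSum_single (f := fun k => ((PowerSeries.coeff k (PowerSeries.C (⟨a, ha⟩ : 𝒜)) : 𝒜) :
      ι → L) s * t ^ k) 0 (fun k hk => by simp [PowerSeries.coeff_C, hk]) using 1
    simp

theorem var : IsAnalyticFamily 𝒜 ρ fun t _ => t := by
  refine ⟨PowerSeries.X, fun r hr _ => ⟨r, fun k s => ?_⟩, fun t _ s => ?_⟩
  · rw [PowerSeries.coeff_X]
    split_ifs with h
    · simp [h]
    · simpa using hr.le
  · convert hasSum_single (f := fun k => ((PowerSeries.coeff k (PowerSeries.X : PowerSeries 𝒜) : 𝒜) :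
      ι → L) s * t ^ k) 1 (fun k hk => by simp [PowerSeries.coeff_X, hk]) using 1
    simp [PowerSeries.coeff_X]

variable [IsUltrametricDist L]

theorem add (hf : IsAnalyticFamily 𝒜 ρ f) (hg : IsAnalyticFamily 𝒜 ρ g) :
    IsAnalyticFamily 𝒜 ρ fun t s => f t s + g t s := by
  obtain ⟨φ, h1, h2⟩ := hf
  obtain ⟨ψ, h3, h4⟩ := hg
  refine ⟨φ + ψ, fun r hr hr' => ?_, fun t ht s => ?_⟩
  · obtain ⟨C, hC⟩ := h1 r hr hr'
    obtain ⟨C', hC'⟩ := h3 r hr hr'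
    refine ⟨max C C', fun k s => ?_⟩
    rw [map_add, ← le_div_iff₀ (by positivity)]
    refine norm_add_le_of_norm_le ?_ ?_ <;> rw [le_div_iff₀ (by positivity)]
    · exact (hC k s).trans (le_max_left _ _)
    · exact (hC' k s).trans (le_max_right _ _)
  · simpa [add_mul] using (h2 t ht s).add (h4 t ht s)

theorem mul [CompleteSpace L] (hf : IsAnalyticFamily 𝒜 ρ f) (hg : IsAnalyticFamily 𝒜 ρ g) :
    IsAnalyticFamily 𝒜 ρ fun t s => f t s * g t s := by
  obtain ⟨φ, h1, h2⟩ := hf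
  obtain ⟨ψ, h3, h4⟩ := hg
  have hcoeff : ∀ k s, ((PowerSeries.coeff k (φ * ψ) : 𝒜) : ι → L) s =
      ∑ p ∈ Finset.HasAntidiagonal.antidiagonal k, ((PowerSeries.coeff p.1 φ : 𝒜) : ι → L) s *
        ((PowerSeries.coeff p.2 ψ : 𝒜) : ι → L) s := by
    intro k s
    simp [PowerSeries.coeff_mul]
  refine ⟨φ * ψ, fun r hr hr' => ?_, fun t ht s => ?_⟩
  · obtain ⟨C, hC⟩ := h1 r hr hr'
    obtain ⟨C', hC'⟩ := h3 r hr hr'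
    refine ⟨C * C', fun k s => ?_⟩
    rw [hcoeff]
    exact norm_sum_antidiagonal_mul_pow_le hr (fun k => hC k s) (fun k => hC' k s) k
  · obtain ⟨r, hr, hr'⟩ := exists_between ht
    have hr0 := (norm_nonneg t).trans_lt hr
    obtain ⟨C, hC⟩ := h1 r hr0 hr'
    obtain ⟨C', hC'⟩ := h3 r hr0 hr'
    simp only [hcoeff]
    exact hasSum_antidiagonal_mul_pow hr0 (fun k => hC k s) (fun k => hC' k s) hr (h2 t ht s)
      (h4 t ht s)

/-- The ring of analytic families. -/
def _root_.QDiff.analyticFamily [CompleteSpace L] (𝒜 : Subring (ι → L)) (ρ : ℝ) :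
    Subring (L → ι → L) where
  carrier := {f | IsAnalyticFamily 𝒜 ρ f}
  mul_mem' := mul
  one_mem' := const 𝒜.one_mem ⟨‖(1 : L)‖, fun _ => le_rfl⟩
  add_mem' := add
  zero_mem' := const 𝒜.zero_mem ⟨‖(0 : L)‖, fun _ => le_rfl⟩
  neg_mem' {f} hf := by
    have h : IsAnalyticFamily 𝒜 ρ fun _ _ => (-1 : L) :=
      const (𝒜.neg_mem 𝒜.one_mem) ⟨‖(-1 : L)‖, fun _ => le_rfl⟩
    exact (mul h hf).congr fun t _ s => by simp

variable [CompleteSpace L] [IsAlgClosed L]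

/-- The lower bound makes the constant coefficient 1 dominant, so every coefficient of f has
weighted norm at most 1, and the recursion for the formal inverse propagates this bound. As the
constant coefficient is the unit 1 of 𝒜, the inverse keeps its coefficients in 𝒜. -/
theorem inv (h0 : ∀ s, f 0 s = 1)
    (hδ : ∀ r, 0 < r → r < ρ → ∃ δ > 0, ∀ t, ‖t‖ ≤ r → ∀ s, δ ≤ ‖f t s‖)
    (hf : IsAnalyticFamily 𝒜 ρ f) : IsAnalyticFamily 𝒜 ρ fun t s => (f t s)⁻¹ := by
  obtain ⟨φ, h1, h2⟩ := hf
  rcases le_or_gt ρ 0 with hρ | hρ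
  · exact ⟨0, fun r hr hr' => absurd (hr.trans hr') hρ.not_gt,
      fun t ht => absurd ((norm_nonneg t).trans_lt ht) hρ.not_gt⟩
  have hφ0 : PowerSeries.constantCoeff φ = ((1 : 𝒜ˣ) : 𝒜) := by
    ext s
    have h3 := h2 0 (by simpa using hρ) s
    have h4 := h3.unique (hasSum_single 0 fun k hk => by simp [hk])
    rw [h0] at h4
    simpa using h4.symm
  set ψ := PowerSeries.invOfUnit φ 1
  have hφψ : φ * ψ = 1 := PowerSeries.mul_invOfUnit φ 1 hφ0
  have hφr : ∀ r, 0 < r → r < ρ → ∀ k s, ‖((PowerSeries.coeff k φ : 𝒜) : ι → L) s‖ * r ^ k ≤ 1 := by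
    intro r hr hr' k s
    obtain ⟨r', hrr', hr'ρ⟩ := exists_between hr'
    obtain ⟨C, hC⟩ := h1 r' (hr.trans hrr') hr'ρ
    obtain ⟨δ, hδ0, hδ⟩ := hδ r hr hr'
    have := norm_coeff_mul_pow_le_of_le_norm hr hrr' (fun k => hC k s)
      (fun t ht => h2 t (ht.trans_lt hr') s) hδ0 (fun t ht => hδ t ht s) k
    rw [PowerSeries.coeff_zero_eq_constantCoeff_apply, hφ0] at this
    simpa using this
  have hψr : ∀ r, 0 < r → r < ρ → ∀ k s, ‖((PowerSeries.coeff k ψ : 𝒜) : ι → L) s‖ * r ^ k ≤ 1 := by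
    intro r hr hr' k s
    induction k using Nat.strong_induction_on with
    | _ k ih =>
    rw [PowerSeries.coeff_invOfUnit]
    split_ifs with hk
    · simp [hk]
    · simp only [inv_one, Units.val_one, neg_mul, one_mul, NegMemClass.coe_neg, Pi.neg_apply,
        norm_neg, AddSubmonoidClass.coe_finsetSum, Finset.sum_apply]
      rw [← le_div_iff₀ (by positivity)]
      refine IsUltrametricDist.norm_sum_le_of_forall_le_of_nonneg (by positivity) fun p hp => ?_
      split_ifs with hpk
      · rw [le_div_iff₀ (by positivity)]
        rw [← Finset.HasAntidiagonal.mem_antidiagonal.1 hp, pow_add]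
        simp only [MulMemClass.coe_mul, Pi.mul_apply, norm_mul]
        calc _ = (‖((PowerSeries.coeff p.1 φ : 𝒜) : ι → L) s‖ * r ^ p.1) *
              (‖((PowerSeries.coeff p.2 ψ : 𝒜) : ι → L) s‖ * r ^ p.2) := by ring
          _ ≤ 1 * 1 := mul_le_mul (hφr r hr hr' _ s) (ih _ hpk) (by positivity) zero_le_one
          _ = 1 := one_mul 1
      · simp only [ZeroMemClass.coe_zero, Pi.zero_apply, norm_zero]
        positivity
  refine ⟨ψ, fun r hr hr' => ⟨1, hψr r hr hr'⟩, fun t ht s => ?_⟩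
  obtain ⟨r, hr, hr'⟩ := exists_between ht
  have hr0 := (norm_nonneg t).trans_lt hr
  have hψsum := (summable_norm_mul_pow hr0 (fun k => hψr r hr0 hr' k s) hr).of_norm.hasSum
  have hmul := hasSum_antidiagonal_mul_pow hr0 (fun k => hφr r hr0 hr' k s)
    (fun k => hψr r hr0 hr' k s) hr (h2 t ht s) hψsum
  have hcoeff : ∀ k, (∑ p ∈ Finset.HasAntidiagonal.antidiagonal k,
      ((PowerSeries.coeff p.1 φ : 𝒜) : ι → L) s * ((PowerSeries.coeff p.2 ψ : 𝒜) : ι → L) s) =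
      if k = 0 then 1 else 0 := by
    intro k
    have := congrArg (fun a : 𝒜 => (a : ι → L) s) (PowerSeries.coeff_mul k φ ψ)
    simp only [hφψ, PowerSeries.coeff_one] at this
    rw [apply_ite (fun a : 𝒜 => (a : ι → L) s)] at this
    simpa using this.symm
  simp only [hcoeff] at hmul
  have hone := hmul.unique (hasSum_single 0 fun k hk => by simp [hk])
  simp only [if_true, pow_zero, mul_one] at hone
  rwa [eq_inv_of_mul_eq_one_right hone] at hψsum

/-- Analytic families are closed under limits that are uniform on all smaller disks. -/
theorem of_tendsto (hL : ∃ x : L, 1 < ‖x‖)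
    (h𝒜 : ∀ a : ι → L, (∀ ε > 0, ∃ b ∈ 𝒜, ∀ s, ‖a s - b s‖ ≤ ε) → a ∈ 𝒜) {F : ℕ → L → ι → L}
    (hF : ∀ m, IsAnalyticFamily 𝒜 ρ (F m))
    (hlim : ∀ r, 0 < r → r < ρ → ∀ ε > 0, ∃ M, ∀ m ≥ M, ∀ t, ‖t‖ ≤ r → ∀ s,
      ‖f t s - F m t s‖ ≤ ε) : IsAnalyticFamily 𝒜 ρ f := by
  rcases le_or_gt ρ 0 with hρ | hρ
  · exact ⟨0, fun r hr hr' => absurd (hr.trans hr') hρ.not_gt,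
      fun t ht => absurd ((norm_nonneg t).trans_lt ht) hρ.not_gt⟩
  choose φ h1 h2 using hF
  -- The Cauchy estimate for F m - F m' turns uniform closeness of functions into closeness of
  -- coefficients, uniform in both k and s.
  have hcauchy : ∀ r, 0 < r → r < ρ → ∀ ε > 0, ∃ M, ∀ m ≥ M, ∀ m' ≥ M, ∀ k s,
      ‖((PowerSeries.coeff k (φ m) : 𝒜) : ι → L) s -
        ((PowerSeries.coeff k (φ m') : 𝒜) : ι → L) s‖ * r ^ k ≤ ε := by
    intro r hr hr' ε hε
    obtain ⟨M, hM⟩ := hlim r hr hr' ε hε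
    refine ⟨M, fun m hm m' hm' k s => ?_⟩
    obtain ⟨r', hrr', hr'ρ⟩ := exists_between hr'
    obtain ⟨C, hC⟩ := h1 m r' (hr.trans hrr') hr'ρ
    obtain ⟨C', hC'⟩ := h1 m' r' (hr.trans hrr') hr'ρ
    refine norm_coeff_mul_pow_le_of_norm_le hL (r' := r') (C := max C C')
      (a := fun k => ((PowerSeries.coeff k (φ m) : 𝒜) : ι → L) s -
        ((PowerSeries.coeff k (φ m') : 𝒜) : ι → L) s)
      (f := fun t => F m t s - F m' t s) hr hrr' ?_ ?_ ?_ k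
    · intro k
      rw [← le_div_iff₀ (pow_pos (hr.trans hrr') k)]
      refine norm_sub_le_of_norm_le ?_ ?_ <;> rw [le_div_iff₀ (pow_pos (hr.trans hrr') k)]
      · exact (hC k s).trans (le_max_left _ _)
      · exact (hC' k s).trans (le_max_right _ _)
    · intro t ht
      simpa [sub_mul] using (h2 m t (ht.trans_lt hr') s).sub (h2 m' t (ht.trans_lt hr') s)
    · intro t ht
      have := norm_sub_le_of_norm_le (hM m' hm' t ht s) (hM m hm t ht s)
      simpa using this
  have hconv : ∀ k s, ∃ b, Tendsto (fun m => ((PowerSeries.coeff k (φ m) : 𝒜) : ι → L) s) atTop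
      (𝓝 b) := by
    intro k s
    refine cauchySeq_tendsto_of_complete (Metric.cauchySeq_iff'.2 fun ε hε => ?_)
    have hr : 0 < ρ / 2 := by positivity
    obtain ⟨M, hM⟩ := hcauchy (ρ / 2) hr (by linarith) (ε / 2 * (ρ / 2) ^ k) (by positivity)
    refine ⟨M, fun m hm => ?_⟩
    rw [dist_eq_norm]
    have := le_of_mul_le_mul_right (hM m hm M le_rfl k s) (by positivity)
    linarith
  choose b hb using hconv
  have hbφ : ∀ r, 0 < r → r < ρ → ∀ ε > 0, ∃ M, ∀ m ≥ M, ∀ k s,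
      ‖b k s - ((PowerSeries.coeff k (φ m) : 𝒜) : ι → L) s‖ * r ^ k ≤ ε := by
    intro r hr hr' ε hε
    obtain ⟨M, hM⟩ := hcauchy r hr hr' ε hε
    refine ⟨M, fun m hm k s => ?_⟩
    have := (((hb k s).sub_const (((PowerSeries.coeff k (φ m) : 𝒜) : ι → L) s)).norm).mul_const
      (r ^ k)
    exact le_of_tendsto this (eventually_atTop.2 ⟨M, fun m' hm' => hM m' hm' m hm k s⟩)
  have hbmem : ∀ k, b k ∈ 𝒜 := by
    intro k
    refine h𝒜 _ fun ε hε => ?_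
    have hr : 0 < ρ / 2 := by positivity
    obtain ⟨M, hM⟩ := hbφ (ρ / 2) hr (by linarith) (ε * (ρ / 2) ^ k) (by positivity)
    exact ⟨_, (PowerSeries.coeff k (φ M)).2, fun s =>
      le_of_mul_le_mul_right (hM M le_rfl k s) (by positivity)⟩
  have hbC : ∀ r, 0 < r → r < ρ → ∃ C, ∀ k s, ‖b k s‖ * r ^ k ≤ C := by
    intro r hr hr'
    obtain ⟨M, hM⟩ := hbφ r hr hr' 1 one_pos
    obtain ⟨C, hC⟩ := h1 M r hr hr'
    refine ⟨max 1 C, fun k s => ?_⟩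
    rw [← sub_add_cancel (b k s) (((PowerSeries.coeff k (φ M) : 𝒜) : ι → L) s),
      ← le_div_iff₀ (by positivity)]
    refine norm_add_le_of_norm_le ?_ ?_ <;> rw [le_div_iff₀ (by positivity)]
    · exact (hM M le_rfl k s).trans (le_max_left _ _)
    · exact (hC k s).trans (le_max_right _ _)
  refine ⟨PowerSeries.mk fun k => ⟨b k, hbmem k⟩, ?_, ?_⟩
  · simpa only [PowerSeries.coeff_mk] using hbC
  · intro t ht s
    simp only [PowerSeries.coeff_mk]
    obtain ⟨r, hr, hr'⟩ := exists_between ht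
    have hr0 := (norm_nonneg t).trans_lt hr
    obtain ⟨C, hC⟩ := hbC r hr0 hr'
    have hsum := (summable_norm_mul_pow hr0 (fun k => hC k s) hr).of_norm.hasSum
    suffices h : f t s = ∑' k, b k s * t ^ k by rwa [h]
    rw [← sub_eq_zero, ← norm_le_zero_iff]
    refine le_of_forall_gt_imp_ge_of_dense fun ε hε => ?_
    obtain ⟨M, hM⟩ := hlim r hr0 hr' ε hε
    obtain ⟨M', hM'⟩ := hbφ r hr0 hr' ε hε
    have hd := hsum.sub (h2 (max M M') t ht s)
    have h3 : ‖(∑' k, b k s * t ^ k) - F (max M M') t s‖ ≤ ε := by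
      refine norm_le_of_hasSum_of_forall_norm_le hd fun k => ?_
      rw [← sub_mul, norm_mul, norm_pow]
      refine le_trans ?_ (hM' (max M M') (le_max_right _ _) k s)
      gcongr
    have := norm_sub_le_of_norm_le (hM (max M M') (le_max_left _ _) t hr.le s) h3
    simpa using this

end IsAnalyticFamily

end Family

/-! ### Analytic functions on an open disk. -/

section Disk

variable {L : Type*} [NormedField L] [IsUltrametricDist L] [CompleteSpace L]

/-- The ring of functions that are analytic on the open disk of radius `R` around `c`. -/
def analyticOnDisk (c : L) (R : ℝ) : Subring (L → L) :=
  (analyticFamily (⊤ : Subring (Unit → L)) R).comap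
    { toFun := fun f t _ => f (c + t)
      map_one' := rfl
      map_mul' := fun _ _ => rfl
      map_zero' := rfl
      map_add' := fun _ _ => rfl }

variable {c : L} {R : ℝ} {f : L → L}

theorem exists_coeff_of_mem (hf : f ∈ analyticOnDisk c R) : ∃ a : ℕ → L,
    (∀ r, 0 < r → r < R → ∃ C, ∀ k, ‖a k‖ * r ^ k ≤ C) ∧
    ∀ x, ‖x - c‖ < R → HasSum (fun k => a k * (x - c) ^ k) (f x) := by
  obtain ⟨φ, h1, h2⟩ := hf
  refine ⟨fun k => ((PowerSeries.coeff k φ : (⊤ : Subring (Unit → L))) : Unit → L) (),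
    fun r hr hr' => ?_, fun x hx => ?_⟩
  · obtain ⟨C, hC⟩ := h1 r hr hr'
    exact ⟨C, fun k => hC k ()⟩
  · simpa using h2 (x - c) hx ()

theorem const_mem_analyticOnDisk (a : L) : (fun _ => a) ∈ analyticOnDisk c R :=
  IsAnalyticFamily.const (Subring.mem_top _) ⟨‖a‖, fun _ => le_rfl⟩

theorem id_mem_analyticOnDisk : (fun x => x) ∈ analyticOnDisk c R :=
  (IsAnalyticFamily.const (Subring.mem_top _) ⟨‖c‖, fun _ => le_rfl⟩).add IsAnalyticFamily.var

theorem sub_mem_analyticOnDisk {g : L → L} (hf : f ∈ analyticOnDisk c R)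
    (hg : g ∈ analyticOnDisk c R) : (fun x => f x - g x) ∈ analyticOnDisk c R :=
  sub_mem hf hg

theorem mul_mem_analyticOnDisk {g : L → L} (hf : f ∈ analyticOnDisk c R)
    (hg : g ∈ analyticOnDisk c R) : (fun x => f x * g x) ∈ analyticOnDisk c R :=
  mul_mem hf hg

theorem sum_mem_analyticOnDisk {κ : Type*} {s : Finset κ} {g : κ → L → L}
    (hg : ∀ i ∈ s, g i ∈ analyticOnDisk c R) :
    (fun x => ∑ i ∈ s, g i x) ∈ analyticOnDisk c R := by
  have := sum_mem hg
  rwa [Finset.sum_fn] at this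

theorem prod_mem_analyticOnDisk {κ : Type*} {s : Finset κ} {g : κ → L → L}
    (hg : ∀ i ∈ s, g i ∈ analyticOnDisk c R) :
    (fun x => ∏ i ∈ s, g i x) ∈ analyticOnDisk c R := by
  have := prod_mem hg
  rwa [Finset.prod_fn] at this

theorem pow_mem_analyticOnDisk (hf : f ∈ analyticOnDisk c R) (k : ℕ) :
    (fun x => f x ^ k) ∈ analyticOnDisk c R :=
  pow_mem hf k

theorem aeval_mem_analyticOnDisk {K : Type*} [NormedField K] [NormedAlgebra K L] (P : K[X]) :
    (fun x : L => aeval x P) ∈ analyticOnDisk c R := by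
  simp only [aeval_eq_sum_range, Algebra.smul_def]
  exact sum_mem_analyticOnDisk fun i _ => mul_mem_analyticOnDisk (const_mem_analyticOnDisk _)
    (pow_mem_analyticOnDisk id_mem_analyticOnDisk i)

theorem comp_mul_mem_analyticOnDisk {q : L} (hq : ‖q‖ ≤ 1) (hf : f ∈ analyticOnDisk (q * c) R) :
    (fun x => f (q * x)) ∈ analyticOnDisk c R := by
  obtain ⟨a, h1, h2⟩ := exists_coeff_of_mem hf
  refine ⟨PowerSeries.mk fun k => ⟨fun _ => a k * q ^ k, Subring.mem_top _⟩, fun r hr hr' => ?_,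
    fun t ht s => ?_⟩
  · obtain ⟨C, hC⟩ := h1 r hr hr'
    refine ⟨C, fun k s => ?_⟩
    rw [PowerSeries.coeff_mk]
    refine le_trans ?_ (hC k)
    simp only [norm_mul, norm_pow]
    gcongr
    exact mul_le_of_le_one_right (norm_nonneg _) (pow_le_one₀ (norm_nonneg _) hq)
  · have h3 : q * (c + t) - q * c = q * t := by ring
    have h4 := h2 (q * (c + t)) (by
      rw [h3, norm_mul]
      exact (mul_le_of_le_one_left (norm_nonneg _) hq).trans_lt ht)
    simpa [h3, mul_pow, mul_assoc] using h4

/-- If a_k is the first nonzero coefficient, a zero at c + t gives |a_k t^k| ≤ C(|t|/r)^{k+1}, that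
is |a_k| r^{k+1} ≤ C|t|, which fails for small t ≠ 0. -/
theorem eq_zero_of_tendsto_of_mem_analyticOnDisk (hf : f ∈ analyticOnDisk c R) {u : ℕ → L}
    (hu : Tendsto u atTop (𝓝 c)) (huc : ∀ m, u m ≠ c) (hfu : ∀ m, f (u m) = 0) {x : L}
    (hx : ‖x - c‖ < R) : f x = 0 := by
  obtain ⟨a, h1, h2⟩ := exists_coeff_of_mem hf
  have hR : 0 < R := (norm_nonneg _).trans_lt hx
  suffices h : ∀ k, a k = 0 by
    have := h2 x hx
    simp only [h, zero_mul] at this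
    exact this.unique hasSum_zero
  by_contra! hne
  classical
  set k := Nat.find hne
  have hk : a k ≠ 0 := Nat.find_spec hne
  have hlt : ∀ j < k, a j = 0 := fun j hj => not_not.1 (Nat.find_min hne hj)
  obtain ⟨r, hr, hrR⟩ := exists_between hR
  obtain ⟨C, hC⟩ := h1 r hr hrR
  have hC0 : 0 ≤ C := le_trans (by positivity) (hC 0)
  have hn : Tendsto (fun m => ‖u m - c‖) atTop (𝓝 0) := by
    simpa using (hu.sub_const c).norm
  have hn' : Tendsto (fun m => C * ‖u m - c‖) atTop (𝓝 0) := by simpa using hn.const_mul C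
  have hpos : 0 < ‖a k‖ * r ^ (k + 1) := by positivity
  obtain ⟨m, hm1, hm2⟩ := ((hn.eventually_lt_const hr).and (hn'.eventually_lt_const hpos)).exists
  set t := u m - c
  have ht : 0 < ‖t‖ := norm_pos_iff.2 (sub_ne_zero.2 (huc m))
  have h3 := (hasSum_nat_add_iff' (k + 1)).2 (h2 (u m) (hm1.trans hrR))
  rw [hfu, Finset.sum_range_succ, Finset.sum_eq_zero, zero_add, zero_sub] at h3
  · have h4 : ‖-(a k * t ^ k)‖ ≤ C * (‖t‖ / r) ^ (k + 1) := by
      refine norm_le_of_hasSum_of_forall_norm_le h3 fun i => ?_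
      refine (norm_mul_pow_le_mul_pow hr hC le_rfl (i + (k + 1))).trans ?_
      exact mul_le_mul_of_nonneg_left (pow_le_pow_of_le_one (by positivity)
        ((div_le_one hr).2 hm1.le) (Nat.le_add_left _ _)) hC0
    rw [norm_neg, norm_mul, norm_pow, div_pow, mul_div_assoc', le_div_iff₀ (by positivity)] at h4
    have h5 : ‖a k‖ * r ^ (k + 1) * ‖t‖ ^ k ≤ C * ‖t‖ * ‖t‖ ^ k := by
      calc _ = ‖a k‖ * ‖t‖ ^ k * r ^ (k + 1) := by ring
        _ ≤ _ := h4
        _ = _ := by ring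
    exact absurd (le_of_mul_le_mul_right h5 (by positivity)) hm2.not_ge
  · intro j hj
    rw [hlt j (Finset.mem_range.1 hj), zero_mul]

variable [IsAlgClosed L]

/-- Pointwise convergence suffices: the terms are bounded at a point of norm between r and R, which
exists because the value group is dense. -/
theorem IsAnalyticOnDisk.mem (hL : ∃ x : L, 1 < ‖x‖) (hf : IsAnalyticOnDisk c R f) :
    f ∈ analyticOnDisk c R := by
  obtain ⟨a, ha⟩ := hf
  refine ⟨PowerSeries.mk fun k => ⟨fun _ => a k, Subring.mem_top _⟩, fun r hr hr' => ?_,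
    fun t ht s => ?_⟩
  · obtain ⟨t, ht, htR⟩ := exists_norm_mem_Ico hL hr hr'
    have h1 := (ha (c + t) (by simpa using htR)).summable.tendsto_atTop_zero.norm.bddAbove_range
    obtain ⟨C, hC⟩ := h1
    refine ⟨C, fun k s => ?_⟩
    refine le_trans ?_ (hC (Set.mem_range_self k))
    simp only [PowerSeries.coeff_mk, add_sub_cancel_left, norm_mul, norm_pow]
    gcongr
  · simpa using ha (c + t) (by simpa using ht)

theorem mem_analyticOnDisk_of_tendsto (hL : ∃ x : L, 1 < ‖x‖) {F : ℕ → L → L}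
    (hF : ∀ m, F m ∈ analyticOnDisk c R)
    (hlim : ∀ r, 0 < r → r < R → ∀ ε > 0, ∃ M, ∀ m ≥ M, ∀ x, ‖x - c‖ ≤ r → ‖f x - F m x‖ ≤ ε) :
    f ∈ analyticOnDisk c R := by
  refine IsAnalyticFamily.of_tendsto hL (fun _ _ => Subring.mem_top _)
    (F := fun m t _ => F m (c + t)) hF fun r hr hr' ε hε => ?_
  obtain ⟨M, hM⟩ := hlim r hr hr' ε hε
  exact ⟨M, fun m hm t ht s => hM m hm (c + t) (by simpa using ht)⟩

/-- Two open disks of radius R with centres closer than R coincide. The partial sums are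
polynomials, hence analytic around either centre, and they converge uniformly on smaller disks. -/
theorem recenter_mem_analyticOnDisk (hL : ∃ x : L, 1 < ‖x‖) {c' : L} (hc : ‖c' - c‖ < R)
    (hf : f ∈ analyticOnDisk c R) : f ∈ analyticOnDisk c' R := by
  obtain ⟨a, h1, h2⟩ := exists_coeff_of_mem hf
  refine mem_analyticOnDisk_of_tendsto hL
    (F := fun m x => ∑ k ∈ Finset.range m, a k * (x - c) ^ k) (fun m => ?_)
    fun r hr hr' ε hε => ?_
  · exact sum_mem_analyticOnDisk fun k _ => mul_mem_analyticOnDisk (const_mem_analyticOnDisk _)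
      (pow_mem_analyticOnDisk
        (sub_mem_analyticOnDisk id_mem_analyticOnDisk (const_mem_analyticOnDisk _)) k)
  · obtain ⟨r', hr1, hr'R⟩ := exists_between (max_lt hr' hc)
    set r₀ := max r ‖c' - c‖
    have hr₀ : 0 < r₀ := hr.trans_le (le_max_left _ _)
    have hr0' : 0 < r' := hr₀.trans hr1
    obtain ⟨C, hC⟩ := h1 r' hr0' hr'R
    have hC0 : 0 ≤ C := le_trans (by positivity) (hC 0)
    have hθ : r₀ / r' < 1 := (div_lt_one hr0').2 hr1
    have hlim : Tendsto (fun N => C * (r₀ / r') ^ N) atTop (𝓝 0) := by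
      simpa using (tendsto_pow_atTop_nhds_zero_of_lt_one (by positivity) hθ).const_mul C
    obtain ⟨M, hM⟩ := eventually_atTop.1 (hlim.eventually_le_const hε)
    refine ⟨M, fun m hm x hx => ?_⟩
    have hxc : ‖x - c‖ ≤ r₀ := by
      have := norm_add_le_of_norm_le (C := r₀) (hx.trans (le_max_left _ _)) (le_max_right r ‖c' - c‖)
      simpa using this
    have h3 := (hasSum_nat_add_iff' m).2 (h2 x (hxc.trans_lt (hr1.trans hr'R)))
    refine (norm_le_of_hasSum_of_forall_norm_le h3 fun i => ?_).trans (hM m hm)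
    refine (norm_mul_pow_le_mul_pow hr0' hC hxc (i + m)).trans ?_
    exact mul_le_mul_of_nonneg_left (pow_le_pow_of_le_one (by positivity)
        hθ.le (Nat.le_add_left _ _)) hC0

/-- Division by f(c) reduces to `IsAnalyticFamily.inv`, which requires the value 1 at the centre. -/
theorem inv_mem_analyticOnDisk (hf : f ∈ analyticOnDisk c R) (hR : 0 < R) {δ : ℝ} (hδ : 0 < δ)
    (hfδ : ∀ x, ‖x - c‖ < R → δ ≤ ‖f x‖) : (fun x => (f x)⁻¹) ∈ analyticOnDisk c R := by
  have hc : f c ≠ 0 := by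
    rw [← norm_pos_iff]
    exact hδ.trans_le (hfδ c (by simpa using hR))
  have h1 : (fun x => (f c)⁻¹ * f x) ∈ analyticOnDisk c R :=
    mul_mem_analyticOnDisk (const_mem_analyticOnDisk _) hf
  have h2 : (fun x => ((f c)⁻¹ * f x)⁻¹) ∈ analyticOnDisk c R := by
    refine IsAnalyticFamily.inv (fun _ => by simp [hc])
      (fun r hr hr' => ⟨‖f c‖⁻¹ * δ, by positivity, fun t ht s => ?_⟩) h1
    rw [norm_mul, norm_inv]
    gcongr
    exact hfδ (c + t) (by simpa using ht.trans_lt hr')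
  convert mul_mem_analyticOnDisk (const_mem_analyticOnDisk (f c)⁻¹) h2 using 2 with x
  rw [mul_inv, inv_inv, inv_mul_cancel_left₀ hc]

end Disk

/-! ### Analytic elements on the affinoid X. -/

section Affinoid

variable {K : Type*} [NormedField K] {L : Type*} [NormedField L] [NormedAlgebra K L]
  (X : Affinoid K)

theorem Affinoid.minRadius_le (i : Fin (X.m + 1)) : X.minRadius ≤ X.R i :=
  Finset.inf'_le _ (Finset.mem_univ i)

theorem Affinoid.size_pos : 0 < X.size :=
  (X.R_pos 0).trans_le (le_max_right _ _)

variable {X}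

theorem isAnalyticElement_const (a : K) : IsAnalyticElement X fun _ => algebraMap K L a :=
  fun ε hε => ⟨C a, 1, by simp, fun x _ => by simpa using hε.le⟩

theorem isAnalyticElement_id : IsAnalyticElement X fun x : L => x :=
  fun ε hε => ⟨Polynomial.X, 1, by simp, fun x _ => by simpa using hε.le⟩

section

variable [IsUltrametricDist L]

theorem Affinoid.mem_points_of_norm_sub_lt {x y : L} (hy : y ∈ X.points L)
    (hx : ‖x - y‖ < X.minRadius) : x ∈ X.points L := by
  refine ⟨?_, fun i => ?_⟩
  · have h := norm_add_le_of_norm_le (hx.le.trans (X.minRadius_le 0)) hy.1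
    simpa using h
  · by_contra! h
    have h1 : ‖(x - algebraMap K L (X.c i.succ)) - (x - y)‖ < X.R i.succ := by
      rw [sub_eq_add_neg]
      refine (IsUltrametricDist.norm_add_le_max _ _).trans_lt (max_lt h ?_)
      rw [norm_neg]
      exact hx.trans_le (X.minRadius_le _)
    rw [sub_sub_sub_cancel_left] at h1
    exact absurd (hy.2 i) (not_le.2 h1)

theorem Affinoid.norm_le_size {x : L} (hx : x ∈ X.points L) : ‖x‖ ≤ X.size := by
  have h := norm_add_le_of_norm_le (C := X.size) (hx.1.trans (le_max_right _ _))
    (show ‖algebraMap K L (X.c 0)‖ ≤ X.size by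
      rw [norm_algebraMap']
      exact le_max_left _ _)
  simpa using h

/-- A point outside X lies in a removed disk or outside D⁺(c₀,R₀); by the ultrametric inequality its
distance to X is at least the radius of that disk. -/
theorem Affinoid.exists_le_norm_sub {α : L} (hα : α ∉ X.points L) :
    ∃ δ > 0, ∀ x ∈ X.points L, δ ≤ ‖x - α‖ := by
  by_contra! h
  by_cases h0 : ‖α - algebraMap K L (X.c 0)‖ ≤ X.R 0
  · have h1 : ∃ i : Fin X.m, ‖α - algebraMap K L (X.c i.succ)‖ < X.R i.succ := by
      by_contra! h1
      exact hα ⟨h0, h1⟩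
    obtain ⟨i, hi⟩ := h1
    obtain ⟨x, hx, hxα⟩ := h _ (X.R_pos i.succ)
    have h2 : ‖(x - α) + (α - algebraMap K L (X.c i.succ))‖ < X.R i.succ :=
      (IsUltrametricDist.norm_add_le_max _ _).trans_lt (max_lt hxα hi)
    rw [sub_add_sub_cancel] at h2
    exact absurd (hx.2 i) (not_le.2 h2)
  · obtain ⟨x, hx, hxα⟩ := h _ (X.R_pos 0)
    refine h0 ?_
    have h2 := norm_sub_le_of_norm_le hx.1 hxα.le
    rwa [sub_sub_sub_cancel_left, norm_sub_rev, norm_sub_rev] at h2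

/-- Over L the polynomial splits, which reduces the bound to linear factors with roots outside X.
Rational fractions without poles in X are therefore bounded on X. -/
theorem Affinoid.exists_le_norm_aeval [IsAlgClosed L] {Q : K[X]}
    (hQ : ∀ x ∈ X.points L, aeval x Q ≠ 0) : ∃ δ > 0, ∀ x ∈ X.points L, δ ≤ ‖aeval x Q‖ := by
  rcases (X.points L).eq_empty_or_nonempty with he | ⟨x₀, hx₀⟩
  · exact ⟨1, one_pos, by simp [he]⟩
  set P : L[X] := Q.map (algebraMap K L) with hP
  have hPQ : ∀ x : L, aeval x Q = P.eval x := fun x => by rw [hP, eval_map_algebraMap]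
  have hP0 : P ≠ 0 := by
    intro h
    exact hQ x₀ hx₀ (by rw [hPQ, h, eval_zero])
  have hroots : ∀ a ∈ P.roots, a ∉ X.points L := fun a ha haX =>
    hQ a haX (by rw [hPQ]; exact isRoot_of_mem_roots ha)
  have key : ∀ s : Multiset L, (∀ a ∈ s, a ∉ X.points L) →
      ∃ δ > 0, ∀ x ∈ X.points L, δ ≤ ‖((s.map fun a => Polynomial.X - C a).prod).eval x‖ := by
    intro s
    induction s using Multiset.induction_on with
    | empty => exact fun _ => ⟨1, one_pos, by simp⟩
    | cons a s ih =>
      intro hs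
      obtain ⟨δ, hδ, h1⟩ := ih fun b hb => hs b (Multiset.mem_cons_of_mem hb)
      obtain ⟨δ', hδ', h2⟩ := Affinoid.exists_le_norm_sub (hs a (Multiset.mem_cons_self a s))
      refine ⟨δ' * δ, by positivity, fun x hx => ?_⟩
      rw [Multiset.map_cons, Multiset.prod_cons, eval_mul, norm_mul]
      refine mul_le_mul ?_ (h1 x hx) hδ.le (norm_nonneg _)
      simpa using h2 x hx
  obtain ⟨δ, hδ, h1⟩ := key _ hroots
  refine ⟨‖P.leadingCoeff‖ * δ, mul_pos (norm_pos_iff.2 (leadingCoeff_ne_zero.2 hP0)) hδ,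
    fun x hx => ?_⟩
  rw [hPQ, (IsAlgClosed.splits P).eq_prod_roots, eval_mul, eval_C, norm_mul,
    ← (IsAlgClosed.splits P).eq_prod_roots]
  exact mul_le_mul_of_nonneg_left (h1 x hx) (norm_nonneg _)

theorem Affinoid.exists_norm_aeval_le (P : K[X]) :
    ∃ C, 0 ≤ C ∧ ∀ x ∈ X.points L, ‖aeval x P‖ ≤ C := by
  have hs := X.size_pos.le
  refine ⟨∑ i ∈ Finset.range (P.natDegree + 1), ‖P.coeff i‖ * X.size ^ i,
    Finset.sum_nonneg fun i _ => by positivity, fun x hx => ?_⟩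
  rw [aeval_eq_sum_range]
  refine norm_sum_le_of_le _ fun i _ => ?_
  rw [norm_smul, norm_pow]
  gcongr
  exact X.norm_le_size hx

theorem Affinoid.exists_norm_aeval_div_le [IsAlgClosed L] (P : K[X]) {Q : K[X]}
    (hQ : ∀ x ∈ X.points L, aeval x Q ≠ 0) :
    ∃ C, 0 ≤ C ∧ ∀ x ∈ X.points L, ‖aeval x P / aeval x Q‖ ≤ C := by
  obtain ⟨δ, hδ, h1⟩ := Affinoid.exists_le_norm_aeval hQ
  obtain ⟨C, hC, h2⟩ := X.exists_norm_aeval_le (L := L) P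
  refine ⟨C / δ, by positivity, fun x hx => ?_⟩
  rw [norm_div]
  exact div_le_div₀ hC (h2 x hx) hδ (h1 x hx)

theorem IsAnalyticElement.exists_norm_le [IsAlgClosed L] {f : L → L} (hf : IsAnalyticElement X f) :
    ∃ C, 0 ≤ C ∧ ∀ x ∈ X.points L, ‖f x‖ ≤ C := by
  obtain ⟨P, Q, hQ, h⟩ := hf 1 one_pos
  obtain ⟨C, hC, h1⟩ := Affinoid.exists_norm_aeval_div_le P hQ
  refine ⟨1 + C, by positivity, fun x hx => ?_⟩
  rw [← sub_add_cancel (f x) (aeval x P / aeval x Q)]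
  exact (norm_add_le _ _).trans (add_le_add (h x hx) (h1 x hx))

theorem IsAnalyticElement.add {f g : L → L} (hf : IsAnalyticElement X f)
    (hg : IsAnalyticElement X g) : IsAnalyticElement X fun x => f x + g x := by
  intro ε hε
  obtain ⟨P, Q, hQ, h1⟩ := hf ε hε
  obtain ⟨P', Q', hQ', h2⟩ := hg ε hε
  refine ⟨P * Q' + P' * Q, Q * Q', fun x hx => ?_, fun x hx => ?_⟩
  · rw [map_mul]
    exact mul_ne_zero (hQ x hx) (hQ' x hx)
  · have h3 := norm_add_le_of_norm_le (h1 x hx) (h2 x hx)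
    have h4 := hQ x hx
    have h5 := hQ' x hx
    convert h3 using 2
    rw [map_add, map_mul, map_mul, map_mul]
    field_simp
    ring

theorem IsAnalyticElement.mul [IsAlgClosed L] {f g : L → L} (hf : IsAnalyticElement X f)
    (hg : IsAnalyticElement X g) : IsAnalyticElement X fun x => f x * g x := by
  intro ε hε
  obtain ⟨M, hM, hfM⟩ := hf.exists_norm_le
  -- The approximant of g comes before that of f, whose precision depends on its bound M'. The
  -- summand 1 avoids division by zero.
  obtain ⟨P', Q', hQ', h2⟩ := hg (ε / (M + 1)) (by positivity)
  obtain ⟨M', hM', hgM⟩ := Affinoid.exists_norm_aeval_div_le P' hQ'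
  obtain ⟨P, Q, hQ, h1⟩ := hf (ε / (M' + 1)) (by positivity)
  refine ⟨P * P', Q * Q', fun x hx => ?_, fun x hx => ?_⟩
  · rw [map_mul]
    exact mul_ne_zero (hQ x hx) (hQ' x hx)
  · have h3 : f x * g x - aeval x (P * P') / aeval x (Q * Q') =
        f x * (g x - aeval x P' / aeval x Q') +
          (f x - aeval x P / aeval x Q) * (aeval x P' / aeval x Q') := by
      rw [map_mul, map_mul, mul_div_mul_comm]
      ring
    rw [h3]
    refine norm_add_le_of_norm_le ?_ ?_ <;> rw [norm_mul]
    · calc ‖f x‖ * _ ≤ M * (ε / (M + 1)) := mul_le_mul (hfM x hx) (h2 x hx) (norm_nonneg _) hM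
        _ ≤ (M + 1) * (ε / (M + 1)) := by gcongr; linarith
        _ = ε := mul_div_cancel₀ _ (by positivity)
    · calc _ ≤ (ε / (M' + 1)) * M' :=
            mul_le_mul (h1 x hx) (hgM x hx) (norm_nonneg _) (by positivity)
        _ ≤ (ε / (M' + 1)) * (M' + 1) := by gcongr; linarith
        _ = ε := div_mul_cancel₀ _ (by positivity)

theorem isAnalyticElement_of_forall_exists {f : L → L}
    (h : ∀ ε > 0, ∃ g, IsAnalyticElement X g ∧ ∀ x ∈ X.points L, ‖f x - g x‖ ≤ ε) :
    IsAnalyticElement X f := by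
  intro ε hε
  obtain ⟨g, hg, h1⟩ := h ε hε
  obtain ⟨P, Q, hQ, h2⟩ := hg ε hε
  refine ⟨P, Q, hQ, fun x hx => ?_⟩
  have := norm_add_le_of_norm_le (h1 x hx) (h2 x hx)
  simpa using this

/-- The disk lies in X because R ≤ r_X, so denominators are bounded below on it and the
approximating fractions are analytic there; the uniform limit is analytic too. -/
theorem IsAnalyticElement.mem_analyticOnDisk [CompleteSpace L] [IsAlgClosed L]
    (hL : ∃ x : L, 1 < ‖x‖) {f : L → L} (hf : IsAnalyticElement X f) {y : L}
    (hy : y ∈ X.points L) {R : ℝ} (hR : 0 < R) (hRX : R ≤ X.minRadius) :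
    f ∈ analyticOnDisk y R := by
  have hsub : ∀ x, ‖x - y‖ < R → x ∈ X.points L := fun x hx =>
    Affinoid.mem_points_of_norm_sub_lt hy (hx.trans_le hRX)
  choose P Q hQ h using fun m : ℕ => hf (1 / ((m : ℝ) + 1)) Nat.one_div_pos_of_nat
  refine mem_analyticOnDisk_of_tendsto hL (F := fun m x => aeval x (P m) / aeval x (Q m))
    (fun m => ?_) fun r hr hr' ε hε => ?_
  · obtain ⟨δ, hδ, h1⟩ := Affinoid.exists_le_norm_aeval (hQ m)
    simp only [div_eq_mul_inv]
    exact mul_mem_analyticOnDisk (aeval_mem_analyticOnDisk _)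
      (inv_mem_analyticOnDisk (aeval_mem_analyticOnDisk _) hR hδ fun x hx => h1 x (hsub x hx))
  · obtain ⟨M, hM⟩ := exists_nat_one_div_lt hε
    refine ⟨M, fun m hm x hx => (h m x (hsub x (hx.trans_lt hr'))).trans ?_⟩
    exact (Nat.one_div_le_one_div hm).trans hM.le

end

end Affinoid

/-! ### Powers of q, and the q-Taylor formula along q-orbits. -/

section QCalculus

section

variable {k : Type*} [NormedField k] [IsUltrametricDist k]

theorem norm_eq_one_of_norm_sub_one_lt {x : k} (hx : ‖x - 1‖ < 1) : ‖x‖ = 1 := by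
  apply le_antisymm
  · have := norm_add_le_of_norm_le hx.le (norm_one (α := k)).le
    simpa using this
  · by_contra! h
    have h1 : ‖x - (x - 1)‖ < 1 := by
      rw [sub_eq_add_neg]
      refine (IsUltrametricDist.norm_add_le_max _ _).trans_lt (max_lt h ?_)
      rwa [norm_neg]
    simp at h1

theorem norm_pow_sub_one_le {x : k} (hx : ‖x‖ ≤ 1) (i : ℕ) : ‖x ^ i - 1‖ ≤ ‖x - 1‖ := by
  rw [← geom_sum_mul, norm_mul]
  refine mul_le_of_le_one_left (norm_nonneg _) ?_
  refine IsUltrametricDist.norm_sum_le_of_forall_le_of_nonneg zero_le_one fun j _ => ?_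
  rw [norm_pow]
  exact pow_le_one₀ (norm_nonneg _) hx

/-- The cofactor 1 + x + ⋯ + x^{p-1} of x - 1 is p plus terms x^i - 1 of norm at most |x - 1|. -/
theorem norm_pow_prime_sub_one_le {x : k} (hx : ‖x‖ ≤ 1) (p : ℕ) :
    ‖x ^ p - 1‖ ≤ max ‖(p : k)‖ ‖x - 1‖ * ‖x - 1‖ := by
  rw [← geom_sum_mul, norm_mul]
  refine mul_le_mul_of_nonneg_right ?_ (norm_nonneg _)
  have h : ∑ i ∈ Finset.range p, x ^ i = (p : k) + ∑ i ∈ Finset.range p, (x ^ i - 1) := by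
    simp
  rw [h]
  refine norm_add_le_of_norm_le (le_max_left _ _) ((?_ : _ ≤ _).trans (le_max_right _ _))
  exact IsUltrametricDist.norm_sum_le_of_forall_le_of_nonneg (norm_nonneg _) fun j _ =>
    norm_pow_sub_one_le hx j

/-- Raising to the p-th power contracts the distance to 1 by the factor max(|p|, |x - 1|) < 1. -/
theorem tendsto_pow_prime_pow {x : k} (hx : ‖x - 1‖ < 1) {p : ℕ} (hp : ‖(p : k)‖ < 1) :
    Tendsto (fun m => x ^ p ^ m) atTop (𝓝 1) := by
  have hx1 : ‖x‖ = 1 := norm_eq_one_of_norm_sub_one_lt hx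
  have hθ : max ‖(p : k)‖ ‖x - 1‖ < 1 := max_lt hp hx
  have hθ0 : 0 ≤ max ‖(p : k)‖ ‖x - 1‖ := (norm_nonneg _).trans (le_max_left _ _)
  have key : ∀ m, ‖x ^ p ^ m - 1‖ ≤ (max ‖(p : k)‖ ‖x - 1‖) ^ m := by
    intro m
    induction m with
    | zero => simpa using hx.le
    | succ m ih =>
      have h1 : ‖x ^ p ^ m‖ ≤ 1 := by rw [norm_pow, hx1, one_pow]
      have h2 := norm_pow_prime_sub_one_le h1 p
      rw [← pow_mul, ← pow_succ] at h2
      refine h2.trans ?_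
      rw [pow_succ']
      have h3 := norm_pow_sub_one_le hx1.le (p ^ m)
      gcongr
  rw [tendsto_iff_norm_sub_tendsto_zero]
  exact squeeze_zero (fun _ => norm_nonneg _) key (tendsto_pow_atTop_nhds_zero_of_lt_one hθ0 hθ)

theorem norm_sub_sum_range_le {f : ℕ → k} {s : k} {C θ : ℝ} (hs : HasSum f s) (hC : 0 ≤ C)
    (hθ : 0 ≤ θ) (hθ' : θ ≤ 1) (hf : ∀ i, ‖f i‖ ≤ C * θ ^ i) (m : ℕ) :
    ‖s - ∑ i ∈ Finset.range m, f i‖ ≤ C * θ ^ m :=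
  norm_le_of_hasSum_of_forall_norm_le ((hasSum_nat_add_iff' m).2 hs) fun i =>
    (hf (i + m)).trans
      (mul_le_mul_of_nonneg_left (pow_le_pow_of_le_one hθ hθ' (Nat.le_add_left _ _)) hC)

end

variable {K : Type*} [NormedField K] {L : Type*} [NormedField L] [NormedAlgebra K L] {q : K}

theorem qFactorial_zero : qFactorial q 0 = 1 := by simp [qFactorial]

theorem qFactorial_ne_zero (hroot : ∀ k : ℕ, 0 < k → q ^ k ≠ 1) (k : ℕ) : qFactorial q k ≠ 0 := by
  have h1 : q - 1 ≠ 0 := sub_ne_zero.2 (by simpa using hroot 1 one_pos)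
  exact div_ne_zero (Finset.prod_ne_zero_iff.2 fun i _ => sub_ne_zero.2 (hroot _ i.succ_pos))
    (pow_ne_zero _ h1)

theorem qFactorial_succ (k : ℕ) :
    qFactorial q (k + 1) = (q ^ (k + 1) - 1) / (q - 1) * qFactorial q k := by
  rw [qFactorial, qFactorial, Finset.prod_range_succ, pow_succ (q - 1), mul_comm, mul_comm (_ ^ k),
    mul_div_mul_comm]

@[simp]
theorem qPow_zero (x y : L) : qPow q x y 0 = 1 := by simp [qPow]

/-- This is d_q (x-y)_{q,k+1} = [k+1]_q (x-y)_{q,k}, cleared of the denominator (q - 1)x so that it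
also holds at x = 0. -/
theorem qPow_mul_left_sub (x y : L) (k : ℕ) :
    qPow q (algebraMap K L q * x) y (k + 1) - qPow q x y (k + 1) =
      (algebraMap K L q ^ (k + 1) - 1) * x * qPow q x y k := by
  have h : ∏ i ∈ Finset.range k, (algebraMap K L q * x - algebraMap K L q ^ (i + 1) * y) =
      algebraMap K L q ^ k * qPow q x y k := by
    rw [qPow, ← Finset.card_range k, ← Finset.prod_const, Finset.card_range,
      ← Finset.prod_mul_distrib]
    exact Finset.prod_congr rfl fun i _ => by ring
  have h' : qPow q x y (k + 1) = qPow q x y k * (x - algebraMap K L q ^ k * y) := by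
    rw [qPow, Finset.prod_range_succ, ← qPow]
  rw [h', qPow, Finset.prod_range_succ', h]
  ring

theorem qPow_pow_mul_self_eq_zero {i k : ℕ} (h : i < k) (y : L) :
    qPow q (algebraMap K L q ^ i * y) y k = 0 :=
  Finset.prod_eq_zero (Finset.mem_range.2 h) (sub_self _)

theorem qPow_self_eq_zero {k : ℕ} (h : 0 < k) (y : L) : qPow q y y k = 0 := by
  simpa using qPow_pow_mul_self_eq_zero (q := q) h y

/-- Each factor is x - q^i y = (x - y) - (q^i - 1)y with |q^i - 1| ≤ |q - 1|. This is why
admissibility compares |q - 1| max(|c₀|,R₀) with R. -/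
theorem norm_qPow_le [IsUltrametricDist L] (hq : ‖q - 1‖ < 1) [IsUltrametricDist K] {x y : L}
    {r : ℝ} (hxy : ‖x - y‖ ≤ r) (hy : ‖q - 1‖ * ‖y‖ ≤ r) (k : ℕ) : ‖qPow q x y k‖ ≤ r ^ k := by
  have hq1 := norm_eq_one_of_norm_sub_one_lt hq
  rw [qPow, norm_prod]
  refine (Finset.prod_le_prod (fun i _ => norm_nonneg _) (g := fun _ => r) fun i _ => ?_).trans ?_
  · have h : x - algebraMap K L q ^ i * y = (x - y) - algebraMap K L (q ^ i - 1) * y := by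
      rw [map_sub, map_pow, map_one]
      ring
    rw [h]
    refine norm_sub_le_of_norm_le hxy (le_trans ?_ hy)
    rw [norm_mul, norm_algebraMap']
    exact mul_le_mul_of_nonneg_right (norm_pow_sub_one_le hq1.le i) (norm_nonneg _)
  · simp

/-- `A(q^{i-1} y) ⋯ A(q y) A(y)`, the value at `q^i y` of the solution of `Y(qT) = A(T) Y(T)` that
is `1` at `y`. -/
def orbitProd {n : ℕ} (q : L) (A : L → Matrix (Fin n) (Fin n) L) (y : L) :
    ℕ → Matrix (Fin n) (Fin n) L
  | 0 => 1
  | i + 1 => A (q ^ i * y) * orbitProd q A y i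

variable {X : Affinoid K} {n : ℕ} {A : L → Matrix (Fin n) (Fin n) L}
  {H : ℕ → L → Matrix (Fin n) (Fin n) L}

theorem pow_mul_mem_points (hq : Set.MapsTo (fun x : L => algebraMap K L q * x) (X.points L)
    (X.points L)) {y : L} (hy : y ∈ X.points L) (i : ℕ) :
    algebraMap K L q ^ i * y ∈ X.points L := by
  induction i with
  | zero => simpa using hy
  | succ i ih =>
    rw [pow_succ', mul_assoc]
    exact hq ih

/-- The `q`-Taylor formula for `d_q^m Y` at the points of the `q`-orbit of `y`. -/
theorem sum_qPow_smul_eq_mul_orbitProd (hroot : ∀ k : ℕ, 0 < k → q ^ k ≠ 1)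
    (hq : Set.MapsTo (fun x : L => algebraMap K L q * x) (X.points L) (X.points L))
    (hH : IsIteratedMatrix X q A H) {y : L} (hy : y ∈ X.points L) (i : ℕ) :
    ∀ m N : ℕ, i ≤ N →
      ∑ k ∈ Finset.range (N + 1), (qPow q (algebraMap K L q ^ i * y) y k /
        algebraMap K L (qFactorial q k)) • H (k + m) y =
      H m (algebraMap K L q ^ i * y) * orbitProd (algebraMap K L q) A y i := by
  -- The step from i to i + 1 uses the formula for both m and m + 1, with different truncations, so
  -- m and N are kept general; terms with k > i vanish.
  induction i with
  | zero =>
    intro m N _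
    rw [Finset.sum_eq_single 0]
    · simp [qFactorial_zero, orbitProd]
    · intro k _ hk
      rw [qPow_pow_mul_self_eq_zero (Nat.pos_of_ne_zero hk), zero_div, zero_smul]
    · simp
  | succ i ih =>
    rintro m (_ | N) hN
    · omega
    have hN' : i ≤ N := Nat.succ_le_succ_iff.1 hN
    set x := algebraMap K L q ^ i * y with hx
    have hx' : algebraMap K L q ^ (i + 1) * y = algebraMap K L q * x := by
      rw [pow_succ', mul_assoc]
    have hq1 : algebraMap K L (q - 1) ≠ 0 := by
      rw [Ne, map_eq_zero]
      exact sub_ne_zero.2 (by simpa using hroot 1 one_pos)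
    -- By the q-derivative rule, passing from x to qx adds (q - 1)x times the preceding coefficient.
    -- The sum at qx is thus the formula at x for m plus (q - 1)x times the one for m + 1, which
    -- recombine by the recursion defining H.
    have hdiff : ∀ k, qPow q (algebraMap K L q * x) y (k + 1) /
        algebraMap K L (qFactorial q (k + 1)) =
        qPow q x y (k + 1) / algebraMap K L (qFactorial q (k + 1)) +
          (algebraMap K L q - 1) * x * (qPow q x y k / algebraMap K L (qFactorial q k)) := by
      intro k
      have hk : algebraMap K L (q ^ (k + 1) - 1) ≠ 0 := by
        rw [Ne, map_eq_zero]
        exact sub_ne_zero.2 (hroot _ k.succ_pos)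
      have hk' : algebraMap K L (qFactorial q k) ≠ 0 := by
        rw [Ne, map_eq_zero]
        exact qFactorial_ne_zero hroot k
      rw [← sub_eq_iff_eq_add', ← sub_div, qPow_mul_left_sub, qFactorial_succ, map_mul, map_div₀]
      rw [map_sub, map_pow, map_one] at hk
      rw [map_sub, map_one] at hq1
      rw [map_sub, map_pow, map_one, map_sub, map_one]
      field_simp
    have h1 := ih m (N + 1) (by omega)
    have h2 := ih (m + 1) N hN'
    rw [Finset.sum_range_succ'] at h1
    rw [hx', Finset.sum_range_succ']
    simp only [hdiff, add_smul, Finset.sum_add_distrib, mul_smul]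
    rw [← Finset.smul_sum, ← Finset.smul_sum]
    have h3 : ∀ k, k + 1 + m = k + (m + 1) := fun k => by ring
    simp only [qPow_zero, h3] at h1 ⊢
    rw [h2, add_right_comm, h1, orbitProd, ← hx, ← Matrix.mul_assoc, ← smul_mul_assoc,
      ← smul_mul_assoc, ← add_mul, smul_smul, hH.succ m x (pow_mul_mem_points hq hy i)]
    simp

/-- All terms with k > i contain the factor x - q^i y = 0, so no convergence is involved. -/
theorem taylorSolution_pow_mul_self (hroot : ∀ k : ℕ, 0 < k → q ^ k ≠ 1)
    (hq : Set.MapsTo (fun x : L => algebraMap K L q * x) (X.points L) (X.points L))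
    (hH : IsIteratedMatrix X q A H) {y : L} (hy : y ∈ X.points L) (i : ℕ) :
    taylorSolution q H (algebraMap K L q ^ i * y) y = orbitProd (algebraMap K L q) A y i := by
  rw [taylorSolution, tsum_eq_sum (s := Finset.range (i + 1))]
  · have := sum_qPow_smul_eq_mul_orbitProd hroot hq hH hy i 0 i le_rfl
    rw [hH.zero _ (pow_mul_mem_points hq hy i), one_mul] at this
    exact this
  · intro k hk
    rw [taylorTerm, qPow_pow_mul_self_eq_zero (by simpa using hk), zero_div, zero_smul]

theorem taylorSolution_self (hH : IsIteratedMatrix X q A H) {y : L} (hy : y ∈ X.points L) :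
    taylorSolution q H y y = 1 := by
  rw [taylorSolution, tsum_eq_single 0]
  · simp [taylorTerm, qFactorial_zero, hH.zero y hy]
  · intro k hk
    rw [taylorTerm, qPow_self_eq_zero (Nat.pos_of_ne_zero hk), zero_div, zero_smul]

end QCalculus

/-! ### Convergence of the generic q-Taylor solution and comparison with other solutions. -/

section TaylorSolution

variable {K : Type*} [NormedField K] {L : Type*} [NormedField L] [NormedAlgebra K L]
  {X : Affinoid K} {q : K} {n : ℕ} {A : L → Matrix (Fin n) (Fin n) L}
  {H : ℕ → L → Matrix (Fin n) (Fin n) L} {R : ℝ}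

theorem enorm_le_affinoidMatrixNorm {B : L → Matrix (Fin n) (Fin n) L} {y : L}
    (hy : y ∈ X.points L) (i j : Fin n) : ‖B y i j‖ₑ ≤ affinoidMatrixNorm X B :=
  (le_iSup₂ (f := fun y (_ : y ∈ X.points L) => ‖B y i j‖ₑ) y hy).trans
    (le_iSup₂ (f := fun i j => affinoidNorm X fun x => B x i j) i j)

theorem eventually_norm_mul_pow_le (hR : ENNReal.ofReal R ≤ taylorRadius X q H) {R' : ℝ}
    (hR' : 0 < R') (hR'R : R' < R) :
    ∀ᶠ k in atTop, ∀ y ∈ X.points L, ∀ i j, ‖H k y i j‖ * R' ^ k ≤ ‖qFactorial q k‖ := by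
  have h1 : ENNReal.ofReal R' < taylorRadius X q H :=
    ((ENNReal.ofReal_lt_ofReal_iff (hR'.trans hR'R)).2 hR'R).trans_le hR
  filter_upwards [eventually_lt_of_lt_liminf h1, eventually_gt_atTop 0] with k hk hk0 y hy i j
  have hk0' : (k : ℝ) ≠ 0 := Nat.cast_ne_zero.2 hk0.ne'
  have h2 := ENNReal.rpow_le_rpow hk.le (Nat.cast_nonneg k)
  rw [← ENNReal.rpow_mul, one_div_mul_cancel hk0', ENNReal.rpow_one, ENNReal.rpow_natCast] at h2
  have h3 := ENNReal.mul_le_of_le_div h2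
  have h4 : ‖H k y i j‖ₑ * ENNReal.ofReal R' ^ k ≤ ‖qFactorial q k‖ₑ := by
    rw [mul_comm]
    exact (mul_le_mul_right (enorm_le_affinoidMatrixNorm hy i j) _).trans h3
  rw [← ofReal_norm, ← ofReal_norm, ← ENNReal.ofReal_pow hR'.le,
    ← ENNReal.ofReal_mul (norm_nonneg _)] at h4
  exact (ENNReal.ofReal_le_ofReal_iff (norm_nonneg _)).1 h4

theorem IsTaylorAdmissible.radius_pos (hadm : IsTaylorAdmissible X q A H R) : 0 < R :=
  (mul_nonneg (norm_nonneg _) X.size_pos.le).trans_lt hadm.lt_radius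

theorem pow_mul_ne_self (hroot : ∀ k : ℕ, 0 < k → q ^ k ≠ 1) {k : ℕ} (hk : 0 < k) {y : L}
    (hy : y ≠ 0) : algebraMap K L q ^ k * y ≠ y := by
  intro h
  have h1 : algebraMap K L (q ^ k) = 1 := by
    rw [map_pow]
    exact mul_right_cancel₀ hy (by rw [h, one_mul])
  exact hroot k hk ((map_eq_one_iff _ (algebraMap K L).injective).1 h1)

theorem tendsto_orbit [IsUltrametricDist K] {p : ℕ} (hp : ‖(p : K)‖ < 1) (hq : ‖q - 1‖ < 1) (y : L) :
    Tendsto (fun m => algebraMap K L q ^ p ^ m * y) atTop (𝓝 y) := by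
  have h1 : Tendsto (fun m => algebraMap K L (q ^ p ^ m)) atTop (𝓝 (algebraMap K L 1)) :=
    ((algebraMapCLM K L).continuous.tendsto 1).comp (tendsto_pow_prime_pow hq hp)
  simpa using h1.mul_const y

variable [IsUltrametricDist L]

theorem IsTaylorAdmissible.mem_points (hadm : IsTaylorAdmissible X q A H R) {x y : L}
    (hy : y ∈ X.points L) (hxy : ‖x - y‖ < R) : x ∈ X.points L :=
  Affinoid.mem_points_of_norm_sub_lt hy (hxy.trans_le hadm.radius_le)

theorem IsTaylorAdmissible.norm_mul_sub_lt (hadm : IsTaylorAdmissible X q A H R) {x : L}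
    (hx : x ∈ X.points L) : ‖algebraMap K L q * x - x‖ < R := by
  refine lt_of_le_of_lt ?_ hadm.lt_radius
  have h : algebraMap K L q * x - x = algebraMap K L (q - 1) * x := by
    rw [map_sub, map_one]
    ring
  rw [h, norm_mul, norm_algebraMap']
  exact mul_le_mul_of_nonneg_left (Affinoid.norm_le_size hx) (norm_nonneg _)

theorem IsAnalyticMatrix.exists_norm_le [IsAlgClosed L] {B : L → Matrix (Fin n) (Fin n) L}
    (hB : IsAnalyticMatrix X B) : ∃ C, 0 ≤ C ∧ ∀ y ∈ X.points L, ∀ i j, ‖B y i j‖ ≤ C := by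
  choose C hC0 hC using fun i j => (hB i j).exists_norm_le
  refine ⟨∑ i, ∑ j, C i j, Finset.sum_nonneg fun i _ => Finset.sum_nonneg fun j _ => hC0 i j,
    fun y hy i j => (hC i j y hy).trans ?_⟩
  exact (Finset.single_le_sum (fun j _ => hC0 i j) (Finset.mem_univ j)).trans
    (Finset.single_le_sum (f := fun i => ∑ j, C i j)
      (fun i _ => Finset.sum_nonneg fun j _ => hC0 i j) (Finset.mem_univ i))

theorem exists_norm_mul_pow_le [IsAlgClosed L] (hroot : ∀ k : ℕ, 0 < k → q ^ k ≠ 1)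
    (hH : ∀ k, IsAnalyticMatrix X (H k)) (hR : ENNReal.ofReal R ≤ taylorRadius X q H) {R' : ℝ}
    (hR' : 0 < R') (hR'R : R' < R) :
    ∃ C, 0 ≤ C ∧ ∀ k, ∀ y ∈ X.points L, ∀ i j,
      ‖H k y i j‖ * R' ^ k ≤ C * ‖qFactorial q k‖ := by
  obtain ⟨N, hN⟩ := eventually_atTop.1 (eventually_norm_mul_pow_le hR hR' hR'R)
  choose C hC0 hC using fun k => (hH k).exists_norm_le
  have hf : ∀ k, 0 < ‖qFactorial q k‖ := fun k => norm_pos_iff.2 (qFactorial_ne_zero hroot k)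
  have hC' : ∀ k, 0 ≤ C k * R' ^ k / ‖qFactorial q k‖ := fun k =>
    div_nonneg (mul_nonneg (hC0 k) (pow_nonneg hR'.le k)) (norm_nonneg _)
  have hsum : 0 ≤ ∑ k ∈ Finset.range N, C k * R' ^ k / ‖qFactorial q k‖ :=
    Finset.sum_nonneg fun k _ => hC' k
  -- The lower limit controls only k ≥ N; the finitely many earlier indices are absorbed by the sum.
  refine ⟨1 + ∑ k ∈ Finset.range N, C k * R' ^ k / ‖qFactorial q k‖, by positivity,
    fun k y hy i j => ?_⟩
  rcases le_or_gt N k with hk | hk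
  · refine (hN k hk y hy i j).trans (le_mul_of_one_le_left (norm_nonneg _) ?_)
    linarith
  · rw [← div_le_iff₀ (hf k)]
    calc ‖H k y i j‖ * R' ^ k / ‖qFactorial q k‖ ≤ C k * R' ^ k / ‖qFactorial q k‖ := by
          gcongr
          exact hC k y hy i j
      _ ≤ ∑ k ∈ Finset.range N, C k * R' ^ k / ‖qFactorial q k‖ :=
          Finset.single_le_sum (fun k _ => hC' k) (Finset.mem_range.2 hk)
      _ ≤ _ := by linarith

variable [IsUltrametricDist K]

/-- On `|x - y| ≤ r < R` the generic `q`-Taylor solution converges geometrically and uniformly. -/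
theorem IsTaylorAdmissible.exists_norm_taylorTerm_le [IsAlgClosed L]
    (hadm : IsTaylorAdmissible X q A H R) (hroot : ∀ k : ℕ, 0 < k → q ^ k ≠ 1)
    (hq : ‖q - 1‖ < 1) {r : ℝ} (hr : r < R) :
    ∃ C θ, 0 ≤ C ∧ 0 ≤ θ ∧ θ < 1 ∧ ∀ k, ∀ y ∈ X.points L, ∀ x, ‖x - y‖ ≤ r → ∀ i j,
      ‖taylorTerm q H x y k i j‖ ≤ C * θ ^ k := by
  -- The q-powers grow at most like r₁^k with r₁ = max(r, |q - 1| max(|c₀|,R₀)), and r₁ < R' < R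
  -- leaves room for the ratio r₁/R' < 1.
  obtain ⟨R', h1, h2⟩ := exists_between (max_lt hr hadm.lt_radius)
  set r₁ := max r (‖q - 1‖ * X.size)
  have hr₁ : 0 ≤ r₁ := (mul_nonneg (norm_nonneg _) X.size_pos.le).trans (le_max_right _ _)
  have hR' : 0 < R' := hr₁.trans_lt h1
  obtain ⟨C, hC, hbound⟩ := exists_norm_mul_pow_le hroot hadm.iterated.analytic
    hadm.le_taylorRadius hR' h2
  refine ⟨C, r₁ / R', hC, by positivity, (div_lt_one hR').2 h1, fun k y hy x hxy i j => ?_⟩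
  have hf : 0 < ‖qFactorial q k‖ := norm_pos_iff.2 (qFactorial_ne_zero hroot k)
  have h3 : ‖qPow q x y k‖ ≤ r₁ ^ k := by
    refine norm_qPow_le hq (hxy.trans (le_max_left _ _)) (le_trans ?_ (le_max_right _ _)) k
    exact mul_le_mul_of_nonneg_left (Affinoid.norm_le_size hy) (norm_nonneg _)
  rw [taylorTerm, Matrix.smul_apply, smul_eq_mul, norm_mul, norm_div, norm_algebraMap', div_pow,
    mul_div_assoc', le_div_iff₀ (by positivity), div_mul_eq_mul_div, div_mul_eq_mul_div,
    div_le_iff₀ hf]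
  calc ‖qPow q x y k‖ * ‖H k y i j‖ * R' ^ k = ‖qPow q x y k‖ * (‖H k y i j‖ * R' ^ k) := by ring
    _ ≤ r₁ ^ k * (C * ‖qFactorial q k‖) :=
        mul_le_mul h3 (hbound k y hy i j) (by positivity) (by positivity)
    _ = _ := by ring

variable [CompleteSpace L] [IsAlgClosed L]

theorem IsTaylorAdmissible.summable_taylorTerm
    (hadm : IsTaylorAdmissible X q A H R) (hroot : ∀ k : ℕ, 0 < k → q ^ k ≠ 1)
    (hq : ‖q - 1‖ < 1) {x y : L} (hy : y ∈ X.points L) (hxy : ‖x - y‖ < R) :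
    Summable (taylorTerm q H x y) := by
  obtain ⟨C, θ, hC, hθ, hθ', h⟩ := hadm.exists_norm_taylorTerm_le hroot hq hxy
  refine Pi.summable.2 fun i => Pi.summable.2 fun j => ?_
  refine Summable.of_norm_bounded ((summable_geometric_of_lt_one hθ hθ').mul_left C) fun k => ?_
  exact h k y hy x le_rfl i j

theorem IsTaylorAdmissible.hasSum_taylorTerm_apply
    (hadm : IsTaylorAdmissible X q A H R) (hroot : ∀ k : ℕ, 0 < k → q ^ k ≠ 1)
    (hq : ‖q - 1‖ < 1) {x y : L} (hy : y ∈ X.points L) (hxy : ‖x - y‖ < R) (i j : Fin n) :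
    HasSum (fun k => taylorTerm q H x y k i j) (taylorSolution q H x y i j) :=
  Pi.hasSum.1 (Pi.hasSum.1 (hadm.summable_taylorTerm hroot hq hy hxy).hasSum i) j

theorem IsTaylorAdmissible.exists_norm_sub_sum_taylorTerm_le
    (hadm : IsTaylorAdmissible X q A H R) (hroot : ∀ k : ℕ, 0 < k → q ^ k ≠ 1)
    (hq : ‖q - 1‖ < 1) {r : ℝ} (hr : r < R) {ε : ℝ} (hε : 0 < ε) :
    ∃ M, ∀ m ≥ M, ∀ y ∈ X.points L, ∀ x, ‖x - y‖ ≤ r → ∀ i j,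
      ‖taylorSolution q H x y i j - ∑ k ∈ Finset.range m, taylorTerm q H x y k i j‖ ≤ ε := by
  obtain ⟨C, θ, hC, hθ, hθ', h⟩ := hadm.exists_norm_taylorTerm_le hroot hq hr
  have hlim : Tendsto (fun N => C * θ ^ N) atTop (𝓝 0) := by
    simpa using (tendsto_pow_atTop_nhds_zero_of_lt_one hθ hθ').const_mul C
  obtain ⟨M, hM⟩ := eventually_atTop.1 (hlim.eventually_le_const hε)
  refine ⟨M, fun m hm y hy x hxy i j => le_trans ?_ (hM m hm)⟩
  exact norm_sub_sum_range_le
    (hadm.hasSum_taylorTerm_apply hroot hq hy (hxy.trans_lt hr) i j) hC hθ hθ'.le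
    (fun k => h k y hy x hxy i j) m

theorem IsTaylorAdmissible.taylorSolution_mem_left
    (hadm : IsTaylorAdmissible X q A H R) (hroot : ∀ k : ℕ, 0 < k → q ^ k ≠ 1)
    (hq : ‖q - 1‖ < 1) (hL : ∃ x : L, 1 < ‖x‖) {y : L} (hy : y ∈ X.points L) (i j : Fin n) :
    (fun x => taylorSolution q H x y i j) ∈ analyticOnDisk y R := by
  refine mem_analyticOnDisk_of_tendsto hL
    (F := fun m x => ∑ k ∈ Finset.range m, taylorTerm q H x y k i j) (fun m => ?_)
    fun r hr hr' ε hε => ?_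
  · refine sum_mem_analyticOnDisk fun k _ => ?_
    simp only [taylorTerm, Matrix.smul_apply, smul_eq_mul, div_eq_mul_inv, qPow]
    refine mul_mem_analyticOnDisk (mul_mem_analyticOnDisk ?_ (const_mem_analyticOnDisk _))
      (const_mem_analyticOnDisk _)
    exact prod_mem_analyticOnDisk fun l _ =>
      sub_mem_analyticOnDisk id_mem_analyticOnDisk (const_mem_analyticOnDisk _)
  · obtain ⟨M, hM⟩ := hadm.exists_norm_sub_sum_taylorTerm_le hroot hq hr' hε
    exact ⟨M, fun m hm x hx => hM m hm y hy x hx i j⟩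

/-- Analyticity in y serves to reach y = 0, whose q-orbit is a single point. -/
theorem IsTaylorAdmissible.taylorSolution_mem_right
    (hadm : IsTaylorAdmissible X q A H R) (hroot : ∀ k : ℕ, 0 < k → q ^ k ≠ 1)
    (hq : ‖q - 1‖ < 1) (hL : ∃ x : L, 1 < ‖x‖) {x : L} (hx : x ∈ X.points L) (i j : Fin n) :
    (fun y => taylorSolution q H x y i j) ∈ analyticOnDisk x R := by
  refine mem_analyticOnDisk_of_tendsto hL
    (F := fun m y => ∑ k ∈ Finset.range m, taylorTerm q H x y k i j) (fun m => ?_)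
    fun r hr hr' ε hε => ?_
  · refine sum_mem_analyticOnDisk fun k _ => ?_
    simp only [taylorTerm, Matrix.smul_apply, smul_eq_mul, div_eq_mul_inv, qPow]
    refine mul_mem_analyticOnDisk (mul_mem_analyticOnDisk ?_ (const_mem_analyticOnDisk _))
      ((hadm.iterated.analytic k i j).mem_analyticOnDisk hL hx hadm.radius_pos hadm.radius_le)
    exact prod_mem_analyticOnDisk fun l _ => sub_mem_analyticOnDisk (const_mem_analyticOnDisk _)
      (mul_mem_analyticOnDisk (const_mem_analyticOnDisk _) id_mem_analyticOnDisk)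
  · obtain ⟨M, hM⟩ := hadm.exists_norm_sub_sum_taylorTerm_le hroot hq hr' hε
    refine ⟨M, fun m hm y hy => ?_⟩
    exact hM m hm y (hadm.mem_points hx (hy.trans_lt hr')) x (by rwa [norm_sub_rev]) i j

/-- The generic `q`-Taylor solution solves the equation. -/
theorem IsTaylorAdmissible.taylorSolution_mul (hadm : IsTaylorAdmissible X q A H R)
    (hroot : ∀ k : ℕ, 0 < k → q ^ k ≠ 1) (hq : ‖q - 1‖ < 1)
    (hqX : Set.MapsTo (fun x : L => algebraMap K L q * x) (X.points L) (X.points L))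
    {p : ℕ} (hp : 0 < p) (hpK : ‖(p : K)‖ < 1) (hL : ∃ x : L, 1 < ‖x‖)
    (hA : IsAnalyticMatrix X A) {x y : L} (hy : y ∈ X.points L) (hxy : ‖x - y‖ < R) :
    taylorSolution q H (algebraMap K L q * x) y = A x * taylorSolution q H x y := by
  have hR := hadm.radius_pos
  have hq1 : ‖algebraMap K L q‖ = 1 := by
    rw [norm_algebraMap', norm_eq_one_of_norm_sub_one_lt hq]
  -- For y ≠ 0 both sides are analytic in x and agree at the points q^{p^m}y, which accumulate at y.
  have hne : ∀ y ∈ X.points L, y ≠ 0 → ∀ x, ‖x - y‖ < R →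
      taylorSolution q H (algebraMap K L q * x) y = A x * taylorSolution q H x y := by
    intro y hy hy0 x hxy
    ext i j
    have hd : (fun x => taylorSolution q H (algebraMap K L q * x) y i j -
        ∑ l, A x i l * taylorSolution q H x y l j) ∈ analyticOnDisk y R := by
      refine sub_mem_analyticOnDisk ?_ (sum_mem_analyticOnDisk fun l _ => ?_)
      -- Since |qy - y| < R, the disks of radius R around y and qy coincide, and multiplication by q
      -- preserves this disk.
      · exact comp_mul_mem_analyticOnDisk (f := fun x => taylorSolution q H x y i j) hq1.le
          (recenter_mem_analyticOnDisk hL (hadm.norm_mul_sub_lt hy)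
            (hadm.taylorSolution_mem_left hroot hq hL hy i j))
      · exact mul_mem_analyticOnDisk ((hA i l).mem_analyticOnDisk hL hy hR hadm.radius_le)
          (hadm.taylorSolution_mem_left hroot hq hL hy l j)
    rw [Matrix.mul_apply]
    refine sub_eq_zero.1 (eq_zero_of_tendsto_of_mem_analyticOnDisk hd (tendsto_orbit hpK hq y)
      (fun m => pow_mul_ne_self hroot (pow_pos hp m) hy0) (fun m => ?_) hxy)
    rw [← mul_assoc, ← pow_succ', taylorSolution_pow_mul_self hroot hqX hadm.iterated hy,
      taylorSolution_pow_mul_self hroot hqX hadm.iterated hy, orbitProd, Matrix.mul_apply,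
      sub_self]
  -- For y = 0 the roles change: x is fixed, both sides are analytic in y, and they agree at the
  -- nonzero points c^{m+1}, which tend to 0.
  rcases eq_or_ne y 0 with rfl | hy0
  swap
  · exact hne y hy hy0 x hxy
  ext i j
  have hx : x ∈ X.points L := hadm.mem_points hy hxy
  have hx0 : ‖(0 : L) - x‖ < R := by rwa [norm_sub_rev]
  have hqx0 : ‖(0 : L) - algebraMap K L q * x‖ < R := by
    rwa [zero_sub, norm_neg, norm_mul, hq1, one_mul, ← sub_zero x]
  have hd : (fun y => taylorSolution q H (algebraMap K L q * x) y i j -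
      ∑ l, A x i l * taylorSolution q H x y l j) ∈ analyticOnDisk 0 R := by
    refine sub_mem_analyticOnDisk ?_ (sum_mem_analyticOnDisk fun l _ => mul_mem_analyticOnDisk
      (const_mem_analyticOnDisk _) ?_)
    · exact recenter_mem_analyticOnDisk hL hqx0
        (hadm.taylorSolution_mem_right hroot hq hL (hqX hx) i j)
    · exact recenter_mem_analyticOnDisk hL hx0
        (hadm.taylorSolution_mem_right hroot hq hL hx l j)
  obtain ⟨c, hc0, hc⟩ : ∃ c : L, 0 < ‖c‖ ∧ ‖c‖ < min 1 R := by
    obtain ⟨t, ht, ht'⟩ := exists_norm_mem_Ico hL (half_pos (lt_min one_pos hR))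
      (half_lt_self (lt_min one_pos hR))
    exact ⟨t, (half_pos (lt_min one_pos hR)).trans_le ht, ht'⟩
  have hc1 : ‖c‖ < 1 := hc.trans_le (min_le_left _ _)
  have hcne : ∀ m : ℕ, c ^ (m + 1) ≠ 0 := fun m => pow_ne_zero _ (norm_pos_iff.1 hc0)
  have hcR : ∀ m : ℕ, ‖c ^ (m + 1)‖ < R := fun m => by
    rw [norm_pow]
    exact (pow_le_of_le_one hc0.le hc1.le m.succ_ne_zero).trans_lt (hc.trans_le (min_le_right _ _))
  rw [Matrix.mul_apply]
  refine sub_eq_zero.1 (eq_zero_of_tendsto_of_mem_analyticOnDisk hd (u := fun m => c ^ (m + 1))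
    ?_ hcne (fun m => ?_) (by simpa using hR))
  · exact (tendsto_pow_atTop_nhds_zero_of_norm_lt_one hc1).comp (tendsto_add_atTop_nat 1)
  · have h1 : ‖x - c ^ (m + 1)‖ < R := by
      rw [sub_eq_add_neg]
      refine (IsUltrametricDist.norm_add_le_max _ _).trans_lt (max_lt (by simpa using hxy) ?_)
      rw [norm_neg]
      exact hcR m
    rw [hne _ (hadm.mem_points hy (by simpa using hcR m)) (hcne m) x h1, Matrix.mul_apply, sub_self]

/-- Every solution on a disk is obtained from its value at a point by the generic `q`-Taylor
solution. -/
theorem IsTaylorAdmissible.solution_mul (hadm : IsTaylorAdmissible X q A H R)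
    (hroot : ∀ k : ℕ, 0 < k → q ^ k ≠ 1) (hq : ‖q - 1‖ < 1)
    (hqX : Set.MapsTo (fun x : L => algebraMap K L q * x) (X.points L) (X.points L))
    {p : ℕ} (hp : 0 < p) (hpK : ‖(p : K)‖ < 1) (hL : ∃ x : L, 1 < ‖x‖)
    {Z : L → Matrix (Fin n) (Fin n) L} {y : L} (hy : y ∈ X.points L)
    (hZ : ∀ i j, (fun x => Z x i j) ∈ analyticOnDisk y R)
    (hZA : ∀ x, ‖x - y‖ < R → Z (algebraMap K L q * x) = A x * Z x)
    {T : L} (hT : ‖T - y‖ < R) {Q : L} (hQ : ‖Q - 1‖ < R / X.size) :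
    Z (Q * T) = taylorSolution q H (Q * T) T * Z T := by
  have hTX := hadm.mem_points hy hT
  -- The orbit of 0 does not accumulate, but there QT = T and the claim is Y_A(0,0) = 1.
  rcases eq_or_ne T 0 with rfl | hT0
  · rw [mul_zero, taylorSolution_self hadm.iterated hTX, one_mul]
  ext i j
  have hd : (fun x => Z x i j - ∑ l, taylorSolution q H x T i l * Z T l j) ∈
      analyticOnDisk T R :=
    sub_mem_analyticOnDisk (recenter_mem_analyticOnDisk hL hT (hZ i j))
      (sum_mem_analyticOnDisk fun l _ => mul_mem_analyticOnDisk
        (hadm.taylorSolution_mem_left hroot hq hL hTX i l) (const_mem_analyticOnDisk _))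
  -- The orbit of T never leaves D⁻(y,R), as each step moves a point of X by less than R; the
  -- equation can therefore be iterated.
  have horbit : ∀ k, ‖algebraMap K L q ^ k * T - y‖ < R ∧
      Z (algebraMap K L q ^ k * T) = orbitProd (algebraMap K L q) A T k * Z T := by
    intro k
    induction k with
    | zero => simpa [orbitProd] using hT
    | succ k ih =>
      rw [pow_succ', mul_assoc]
      constructor
      · have h1 := hadm.norm_mul_sub_lt (pow_mul_mem_points hqX hTX k)
        have h2 := (IsUltrametricDist.norm_add_le_max _ _).trans_lt (max_lt h1 ih.1)
        rwa [sub_add_sub_cancel] at h2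
      · rw [hZA _ ih.1, ih.2, orbitProd, Matrix.mul_assoc]
  have hQT : ‖Q * T - T‖ < R := by
    rw [← sub_one_mul, norm_mul]
    calc ‖Q - 1‖ * ‖T‖ ≤ ‖Q - 1‖ * X.size :=
          mul_le_mul_of_nonneg_left (Affinoid.norm_le_size hTX) (norm_nonneg _)
      _ < R := (lt_div_iff₀ X.size_pos).1 hQ
  rw [Matrix.mul_apply]
  refine sub_eq_zero.1 (eq_zero_of_tendsto_of_mem_analyticOnDisk hd (tendsto_orbit hpK hq T)
    (fun m => pow_mul_ne_self hroot (pow_pos hp m) hT0) (fun m => ?_) hQT)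
  rw [(horbit _).2, taylorSolution_pow_mul_self hroot hqX hadm.iterated hTX, Matrix.mul_apply,
    sub_self]

end TaylorSolution

/-! ### Analyticity and invertibility on D × X. -/

section Product

variable {K : Type*} [NormedField K] {L : Type*} [NormedField L] [NormedAlgebra K L]
  {X : Affinoid K} {ρ R : ℝ}

theorem IsAnalyticOnProd.isAnalyticOnDisk {F : L → L → L} (hF : IsAnalyticOnProd X ρ F) {T : L}
    (hT : T ∈ X.points L) : IsAnalyticOnDisk 1 ρ fun Q => F Q T := by
  obtain ⟨a, -, -, h⟩ := hF
  exact ⟨fun k => a k T, fun Q hQ => h Q T hQ hT⟩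

theorem det_mem_of_forall_mem {ι : Type*} {n : ℕ} (𝓡 : Subring (L → ι → L))
    {M : L → ι → Matrix (Fin n) (Fin n) L} (hM : ∀ i j, (fun t s => M t s i j) ∈ 𝓡) :
    (fun t s => (M t s).det) ∈ 𝓡 := by
  have h : (fun t s => (M t s).det) = ∑ σ : Equiv.Perm (Fin n),
      ((Equiv.Perm.sign σ : ℤˣ) : ℤ) • ∏ i, (fun t s => M t s (σ i) i) := by
    funext t s
    simp [Matrix.det_apply, Finset.sum_apply, Finset.prod_apply, Units.smul_def]
  rw [h]
  exact sum_mem fun σ _ => zsmul_mem (prod_mem fun i _ => hM _ _) _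

theorem adjugate_mem_of_forall_mem {ι : Type*} {n : ℕ} (𝓡 : Subring (L → ι → L))
    {M : L → ι → Matrix (Fin n) (Fin n) L} (hM : ∀ i j, (fun t s => M t s i j) ∈ 𝓡)
    (i j : Fin n) : (fun t s => (M t s).adjugate i j) ∈ 𝓡 := by
  simp only [Matrix.adjugate_apply]
  refine det_mem_of_forall_mem 𝓡 fun i' j' => ?_
  simp only [Matrix.updateRow_apply, Pi.single_apply]
  split_ifs
  · exact 𝓡.one_mem
  · exact 𝓡.zero_mem
  · exact hM i' j'

variable [IsUltrametricDist L]

theorem norm_mul_sub_le_of_norm_sub_one_le {T Q : L} (hT : T ∈ X.points L) {r : ℝ}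
    (hQ : ‖Q - 1‖ ≤ r) : ‖Q * T - T‖ ≤ r * X.size := by
  rw [← sub_one_mul, norm_mul]
  exact mul_le_mul hQ (Affinoid.norm_le_size hT) (norm_nonneg _) ((norm_nonneg _).trans hQ)

theorem norm_mul_sub_lt_of_norm_sub_one_lt {T Q : L} (hT : T ∈ X.points L)
    (hQ : ‖Q - 1‖ < R / X.size) : ‖Q * T - T‖ < R :=
  (norm_mul_sub_le_of_norm_sub_one_le hT le_rfl).trans_lt ((lt_div_iff₀ X.size_pos).1 hQ)

variable [IsAlgClosed L]

/-- The ring `ℋ_K(X)`, as a ring of functions on `X(L)`. -/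
def analyticElements (X : Affinoid K) (L : Type*) [NormedField L] [NormedAlgebra K L]
    [IsUltrametricDist L] [IsAlgClosed L] : Subring (X.points L → L) where
  carrier := {f | ∃ g : L → L, IsAnalyticElement X g ∧ ∀ s : X.points L, g s = f s}
  mul_mem' := by
    rintro f f' ⟨g, hg, h⟩ ⟨g', hg', h'⟩
    exact ⟨_, hg.mul hg', fun s => by simp [h, h']⟩
  one_mem' := ⟨_, isAnalyticElement_const 1, fun s => by simp⟩
  add_mem' := by
    rintro f f' ⟨g, hg, h⟩ ⟨g', hg', h'⟩
    exact ⟨_, hg.add hg', fun s => by simp [h, h']⟩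
  zero_mem' := ⟨_, isAnalyticElement_const 0, fun s => by simp⟩
  neg_mem' := by
    rintro f ⟨g, hg, h⟩
    exact ⟨_, (isAnalyticElement_const (-1)).mul hg, fun s => by simp [h]⟩

/-- This is the closedness hypothesis of `IsAnalyticFamily.of_tendsto` for ℋ_K(X). Extension by 0 is
harmless because only values on X count. -/
theorem mem_analyticElements_of_forall_exists {a : X.points L → L}
    (h : ∀ ε > 0, ∃ b ∈ analyticElements X L, ∀ s, ‖a s - b s‖ ≤ ε) :
    a ∈ analyticElements X L := by
  have hext : ∀ s : X.points L, Function.extend Subtype.val a 0 (s : L) = a s :=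
    fun s => Subtype.val_injective.extend_apply _ _ s
  refine ⟨Function.extend Subtype.val a 0, isAnalyticElement_of_forall_exists fun ε hε => ?_, hext⟩
  obtain ⟨b, ⟨g, hg, hgb⟩, hb⟩ := h ε hε
  refine ⟨g, hg, fun x hx => ?_⟩
  have := hb ⟨x, hx⟩
  rwa [← hext, ← hgb] at this

/-- A uniform bound at a radius r' > r gives geometric decay at r. The variable of the family is t =
Q - 1. -/
theorem IsAnalyticFamily.isAnalyticOnProd {F : L → L → L}
    (hF : IsAnalyticFamily (analyticElements X L) ρ fun t (s : X.points L) => F (1 + t) s) :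
    IsAnalyticOnProd X ρ F := by
  obtain ⟨φ, h1, h2⟩ := hF
  choose a ha haφ using fun k => (PowerSeries.coeff k φ).2
  refine ⟨a, ha, fun r hr hr' => ?_, fun Q T hQ hT => ?_⟩
  · obtain ⟨r', hrr', hr'ρ⟩ := exists_between hr'
    have hr'0 := hr.trans hrr'
    obtain ⟨C, hC⟩ := h1 r' hr'0 hr'ρ
    have hlim : Tendsto (fun k => ENNReal.ofReal (C * (r / r') ^ k)) atTop (𝓝 0) := by
      have := (tendsto_pow_atTop_nhds_zero_of_lt_one (by positivity)
        ((div_lt_one hr'0).2 hrr')).const_mul C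
      rw [mul_zero] at this
      simpa using ENNReal.tendsto_ofReal this
    refine tendsto_of_tendsto_of_tendsto_of_le_of_le tendsto_const_nhds hlim
      (fun _ => zero_le) fun k => ?_
    have h3 : affinoidNorm X (a k) ≤ ENNReal.ofReal (C / r' ^ k) := by
      refine iSup₂_le fun x hx => ?_
      rw [← ofReal_norm]
      refine ENNReal.ofReal_le_ofReal ?_
      rw [le_div_iff₀ (by positivity), haφ k ⟨x, hx⟩]
      exact hC k ⟨x, hx⟩
    calc affinoidNorm X (a k) * ENNReal.ofReal r ^ k
        ≤ ENNReal.ofReal (C / r' ^ k) * ENNReal.ofReal r ^ k := mul_le_mul_left h3 _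
      _ = ENNReal.ofReal (C * (r / r') ^ k) := by
        rw [← ENNReal.ofReal_pow hr.le, ← ENNReal.ofReal_mul' (by positivity)]
        congr 1
        rw [div_pow]
        ring
  · have := h2 (Q - 1) hQ ⟨T, hT⟩
    simp only [← haφ, add_sub_cancel] at this
    exact this

variable [CompleteSpace L]

theorem IsAnalyticElement.mem_analyticFamily {f : L → L} (hf : IsAnalyticElement X f) :
    (fun _ (s : X.points L) => f s) ∈ analyticFamily (analyticElements X L) ρ := by
  obtain ⟨C, -, hC⟩ := hf.exists_norm_le
  exact IsAnalyticFamily.const ⟨f, hf, fun _ => rfl⟩ ⟨C, fun s => hC s s.2⟩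

variable [IsUltrametricDist K] {q : K} {n : ℕ} {A : L → Matrix (Fin n) (Fin n) L}
  {H : ℕ → L → Matrix (Fin n) (Fin n) L}

/-- The partial sums are polynomials in t with coefficients in ℋ_K(X), and |(1+t)T - T| ≤ |t|
max(|c₀|,R₀) makes their convergence uniform on smaller disks. -/
theorem IsTaylorAdmissible.taylorSolution_mem_analyticFamily
    (hadm : IsTaylorAdmissible X q A H R) (hroot : ∀ k : ℕ, 0 < k → q ^ k ≠ 1)
    (hq : ‖q - 1‖ < 1) (hL : ∃ x : L, 1 < ‖x‖) (i j : Fin n) :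
    (fun t (s : X.points L) => taylorSolution q H ((1 + t) * s) s i j) ∈
      analyticFamily (analyticElements X L) (R / X.size) := by
  refine IsAnalyticFamily.of_tendsto hL (fun _ => mem_analyticElements_of_forall_exists)
    (F := fun m t (s : X.points L) =>
      ∑ k ∈ Finset.range m, taylorTerm q H ((1 + t) * s) s k i j) (fun m => ?_)
    fun r hr hr' ε hε => ?_
  · have hconst : ∀ a : K, (fun _ _ => algebraMap K L a) ∈
        analyticFamily (analyticElements X L) (R / X.size) :=
      fun a => (isAnalyticElement_const a).mem_analyticFamily
    have hid : (fun _ (s : X.points L) => (s : L)) ∈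
        analyticFamily (analyticElements X L) (R / X.size) :=
      isAnalyticElement_id.mem_analyticFamily
    have hvar : (fun t (_ : X.points L) => t) ∈
        analyticFamily (analyticElements X L) (R / X.size) := IsAnalyticFamily.var
    have hterm : ∀ k, (fun t (s : X.points L) => taylorTerm q H ((1 + t) * s) s k i j) ∈
        analyticFamily (analyticElements X L) (R / X.size) := by
      intro k
      have hqPow : (fun t (s : X.points L) => qPow q ((1 + t) * (s : L)) (s : L) k) =
          ∏ l ∈ Finset.range k, ((1 + fun (t : L) (_ : X.points L) => t) *
            (fun (_ : L) (s : X.points L) => (s : L)) -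
            (fun (_ : L) (_ : X.points L) => algebraMap K L (q ^ l)) *
              fun (_ : L) (s : X.points L) => (s : L)) := by
        funext t s
        simp [qPow, Finset.prod_apply]
      have h1 : (fun t (s : X.points L) => qPow q ((1 + t) * (s : L)) (s : L) k) ∈
          analyticFamily (analyticElements X L) (R / X.size) := by
        rw [hqPow]
        exact prod_mem fun l _ => sub_mem (mul_mem (add_mem (one_mem _) hvar) hid)
          (mul_mem (hconst _) hid)
      have h2 := mul_mem (mul_mem h1 (hconst (qFactorial q k)⁻¹))
        (hadm.iterated.analytic k i j).mem_analyticFamily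
      refine IsAnalyticFamily.congr h2 fun t _ s => ?_
      simp [taylorTerm, div_eq_mul_inv]
    have h := sum_mem (t := Finset.range m) fun k _ => hterm k
    refine IsAnalyticFamily.congr h fun t _ s => ?_
    simp [Finset.sum_apply]
  · have hrR : r * X.size < R := (lt_div_iff₀ X.size_pos).1 hr'
    obtain ⟨M, hM⟩ := hadm.exists_norm_sub_sum_taylorTerm_le hroot hq hrR hε
    refine ⟨M, fun m hm t ht s => hM m hm s s.2 _ ?_ i j⟩
    rw [add_mul, one_mul, add_sub_cancel_left, norm_mul]
    exact mul_le_mul ht (Affinoid.norm_le_size s.2) (norm_nonneg _) hr.le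

/-- The function x ↦ Y_A(x,y) is itself a solution, so `IsTaylorAdmissible.solution_mul` applies to
it. -/
theorem IsTaylorAdmissible.taylorSolution_mul_taylorSolution
    (hadm : IsTaylorAdmissible X q A H R) (hroot : ∀ k : ℕ, 0 < k → q ^ k ≠ 1)
    (hq : ‖q - 1‖ < 1)
    (hqX : Set.MapsTo (fun x : L => algebraMap K L q * x) (X.points L) (X.points L))
    {p : ℕ} (hp : 0 < p) (hpK : ‖(p : K)‖ < 1) (hL : ∃ x : L, 1 < ‖x‖)
    (hA : IsAnalyticMatrix X A) {T y : L} (hy : y ∈ X.points L) (hTy : ‖T - y‖ < R) {Q : L}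
    (hQ : ‖Q - 1‖ < R / X.size) :
    taylorSolution q H (Q * T) y = taylorSolution q H (Q * T) T * taylorSolution q H T y :=
  hadm.solution_mul hroot hq hqX hp hpK hL (Z := fun x => taylorSolution q H x y) hy
    (fun i j => hadm.taylorSolution_mem_left hroot hq hL hy i j)
    (fun _ hx => hadm.taylorSolution_mul hroot hq hqX hp hpK hL hA hy hx) hTy hQ

/-- The cocycle relation at y = QT, together with Y_A(QT,QT) = 1. -/
theorem IsTaylorAdmissible.taylorSolution_mul_swap
    (hadm : IsTaylorAdmissible X q A H R) (hroot : ∀ k : ℕ, 0 < k → q ^ k ≠ 1)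
    (hq : ‖q - 1‖ < 1)
    (hqX : Set.MapsTo (fun x : L => algebraMap K L q * x) (X.points L) (X.points L))
    {p : ℕ} (hp : 0 < p) (hpK : ‖(p : K)‖ < 1) (hL : ∃ x : L, 1 < ‖x‖)
    (hA : IsAnalyticMatrix X A) {T Q : L} (hT : T ∈ X.points L) (hQ : ‖Q - 1‖ < R / X.size) :
    taylorSolution q H (Q * T) T * taylorSolution q H T (Q * T) = 1 := by
  have h1 := norm_mul_sub_lt_of_norm_sub_one_lt hT hQ
  have hQT := hadm.mem_points hT h1
  rw [← hadm.taylorSolution_mul_taylorSolution hroot hq hqX hp hpK hL hA hQT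
    (by rwa [norm_sub_rev]) hQ, taylorSolution_self hadm.iterated hQT]

/-- The reciprocal of this determinant is det Y_A(T,QT), which is bounded above because the uniform
estimate on |x - y| ≤ r max(|c₀|,R₀) is symmetric in T and QT. -/
theorem IsTaylorAdmissible.exists_le_norm_det
    (hadm : IsTaylorAdmissible X q A H R) (hroot : ∀ k : ℕ, 0 < k → q ^ k ≠ 1)
    (hq : ‖q - 1‖ < 1)
    (hqX : Set.MapsTo (fun x : L => algebraMap K L q * x) (X.points L) (X.points L))
    {p : ℕ} (hp : 0 < p) (hpK : ‖(p : K)‖ < 1) (hL : ∃ x : L, 1 < ‖x‖)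
    (hA : IsAnalyticMatrix X A) {r : ℝ} (hr : r < R / X.size) :
    ∃ δ > 0, ∀ Q : L, ‖Q - 1‖ ≤ r → ∀ T ∈ X.points L,
      δ ≤ ‖(taylorSolution q H (Q * T) T).det‖ := by
  obtain ⟨C, θ, hC, hθ, hθ', h⟩ := hadm.exists_norm_taylorTerm_le hroot hq
    ((lt_div_iff₀ X.size_pos).1 hr)
  -- The bound n! Cⁿ of `Matrix.det_le`; M + 1 is used below to have a positive denominator.
  set M : ℝ := (Fintype.card (Fin n)).factorial • C ^ Fintype.card (Fin n)
  have hM : 0 ≤ M := nsmul_nonneg (pow_nonneg hC _) _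
  refine ⟨(M + 1)⁻¹, by positivity, fun Q hQ T hT => ?_⟩
  have h1 := norm_mul_sub_le_of_norm_sub_one_le hT hQ
  have hQ' := hQ.trans_lt hr
  have h1' := norm_mul_sub_lt_of_norm_sub_one_lt hT hQ'
  have hQT := hadm.mem_points hT h1'
  have hdet : ‖(taylorSolution q H T (Q * T)).det‖ ≤ M := by
    refine Matrix.det_le (abv := NormedField.toAbsoluteValue L) fun i j => ?_
    refine norm_le_of_hasSum_of_forall_norm_le
      (hadm.hasSum_taylorTerm_apply hroot hq hQT (by rwa [norm_sub_rev]) i j) fun k => ?_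
    refine (h k _ hQT T (by rwa [norm_sub_rev]) i j).trans ?_
    exact mul_le_of_le_one_right hC (pow_le_one₀ hθ hθ'.le)
  have h2 := congrArg (fun B => ‖B.det‖)
    (hadm.taylorSolution_mul_swap hroot hq hqX hp hpK hL hA hT hQ')
  simp only [Matrix.det_mul, Matrix.det_one, norm_mul, norm_one] at h2
  rw [inv_le_iff_one_le_mul₀ (by positivity), ← h2]
  gcongr
  linarith

/-- The inverse is the adjugate divided by the determinant, and the determinant is 1 at Q = 1, the
normalisation needed by `IsAnalyticFamily.inv`. -/
theorem IsTaylorAdmissible.isAnalyticGLOnProd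
    (hadm : IsTaylorAdmissible X q A H R) (hroot : ∀ k : ℕ, 0 < k → q ^ k ≠ 1)
    (hq : ‖q - 1‖ < 1)
    (hqX : Set.MapsTo (fun x : L => algebraMap K L q * x) (X.points L) (X.points L))
    {p : ℕ} (hp : 0 < p) (hpK : ‖(p : K)‖ < 1) (hL : ∃ x : L, 1 < ‖x‖)
    (hA : IsAnalyticMatrix X A) :
    IsAnalyticGLOnProd X (R / X.size) fun Q T : L => taylorSolution q H (Q * T) T := by
  have hmem := hadm.taylorSolution_mem_analyticFamily hroot hq hL
  refine ⟨fun i j => IsAnalyticFamily.isAnalyticOnProd (hmem i j),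
    fun Q T => (taylorSolution q H (Q * T) T)⁻¹, fun i j => ?_, fun Q T hQ hT => ?_⟩
  · have hdet := det_mem_of_forall_mem _ hmem
    have hinv := IsAnalyticFamily.inv (fun s => by simp [taylorSolution_self hadm.iterated s.2])
      (fun r _ hr' => by
        obtain ⟨δ, hδ, h⟩ := hadm.exists_le_norm_det hroot hq hqX hp hpK hL hA hr'
        exact ⟨δ, hδ, fun t ht s => h (1 + t) (by simpa using ht) s s.2⟩) hdet
    refine IsAnalyticFamily.isAnalyticOnProd
      ((hinv.mul (adjugate_mem_of_forall_mem _ hmem i j)).congr fun t _ s => ?_)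
    simp [Matrix.inv_def]
  · have hunit : IsUnit (taylorSolution q H (Q * T) T).det :=
      (Matrix.isUnit_iff_isUnit_det _).1 (IsUnit.of_mul_eq_one _
        (hadm.taylorSolution_mul_swap hroot hq hqX hp hpK hL hA hT hQ))
    exact ⟨Matrix.mul_nonsing_inv _ hunit, Matrix.nonsing_inv_mul _ hunit⟩

/-- Analytic functions on `D⁻(1, ρ) × X` are determined by their values at the `K`-rational `Q`. -/
theorem IsAnalyticOnProd.eq_of_forall_algebraMap (hL : ∃ x : L, 1 < ‖x‖)
    (hroot : ∀ k : ℕ, 0 < k → q ^ k ≠ 1) (hq : ‖q - 1‖ < 1) (hqρ : ‖q - 1‖ < ρ) {p : ℕ}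
    (hp : 0 < p) (hpK : ‖(p : K)‖ < 1) {F G : L → L → L} (hF : IsAnalyticOnProd X ρ F)
    (hG : IsAnalyticOnProd X ρ G) {T : L} (hT : T ∈ X.points L)
    (h : ∀ q' : K, ‖q' - 1‖ < ρ → G (algebraMap K L q') T = F (algebraMap K L q') T) {Q : L}
    (hQ : ‖Q - 1‖ < ρ) : G Q T = F Q T := by
  have hd := sub_mem_analyticOnDisk ((hG.isAnalyticOnDisk hT).mem hL)
    ((hF.isAnalyticOnDisk hT).mem hL)
  -- The points q^{p^m} lie in K, satisfy |q^{p^m} - 1| ≤ |q - 1| < ρ and accumulate at 1.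
  refine sub_eq_zero.1 (eq_zero_of_tendsto_of_mem_analyticOnDisk hd (tendsto_orbit hpK hq 1)
    (fun m => pow_mul_ne_self hroot (pow_pos hp m) one_ne_zero) (fun m => ?_) hQ)
  rw [mul_one, ← map_pow, sub_eq_zero]
  exact h _ ((norm_pow_sub_one_le (norm_eq_one_of_norm_sub_one_lt hq).le _).trans_lt hqρ)

end Product

end QDiff

/-! ### The main theorem. -/

open QDiff in
theorem mainTheorem1
    {K : Type*} [NontriviallyNormedField K] [IsUltrametricDist K] [CompleteSpace K] [CharZero K]
    (p : ℕ) (hp : p.Prime) (hpK : ‖(p : K)‖ < 1)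
    {L : Type*} [NormedField L] [NormedAlgebra K L] [IsUltrametricDist L] [CompleteSpace L]
    [IsAlgClosed L]
    (X : Affinoid K) (q : K) (hq : q ∈ X.Q₁ L) (hroot : ∀ k : ℕ, 0 < k → q ^ k ≠ 1)
    {n : ℕ} (A : L → Matrix (Fin n) (Fin n) L) (hA : IsAnalyticGL X A)
    (H : ℕ → L → Matrix (Fin n) (Fin n) L) (R : ℝ) (hadm : IsTaylorAdmissible X q A H R) :
    -- the series `Y_A(x, y)` converges on `𝒰_R`
    (∀ x ∈ X.points L, ∀ y ∈ X.points L, ‖x - y‖ < R → Summable (taylorTerm q H x y)) ∧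
    ∃ F : L → L → Matrix (Fin n) (Fin n) L,
      -- `F(Q, T)` is analytic and invertible on `D⁻(1, R / max(|c₀|, R₀)) × X`
      IsAnalyticGLOnProd X (R / X.size) F ∧
      (∀ T ∈ X.points L, F (algebraMap K L q) T = A T) ∧
      (∀ Q : L, ‖Q - 1‖ < R / X.size → SatisfiesAt X R (taylorSolution q H) F Q) ∧
      (∀ Q : L, ‖Q - 1‖ < R / X.size → ∀ T ∈ X.points L,
        F Q T = taylorSolution q H (Q * T) T) ∧
      -- uniqueness
      (∀ G : L → L → Matrix (Fin n) (Fin n) L, IsAnalyticMatrixOnProd X (R / X.size) G →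
        (∀ q' : K, ‖q' - 1‖ < R / X.size →
          SatisfiesAt X R (taylorSolution q H) G (algebraMap K L q')) →
        ∀ Q : L, ‖Q - 1‖ < R / X.size → ∀ T ∈ X.points L, G Q T = F Q T) ∧
      -- independence of the choice of the solution
      (∀ Z : L → L → Matrix (Fin n) (Fin n) L, IsSolutionOn X q A R Z →
        (∀ Q : L, ‖Q - 1‖ < R / X.size → SatisfiesAt X R Z F Q) ∧
        (∀ G : L → L → Matrix (Fin n) (Fin n) L, IsAnalyticMatrixOnProd X (R / X.size) G →
          (∀ q' : K, ‖q' - 1‖ < R / X.size → SatisfiesAt X R Z G (algebraMap K L q')) →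
          ∀ Q : L, ‖Q - 1‖ < R / X.size → ∀ T ∈ X.points L, G Q T = F Q T)) := by
  have hL : ∃ x : L, 1 < ‖x‖ := by
    obtain ⟨x, hx⟩ := NormedField.exists_one_lt_norm K
    exact ⟨algebraMap K L x, by rwa [norm_algebraMap']⟩
  have hq1 := hq.2
  have hqX := hq.1.mapsTo
  have hqρ : ‖q - 1‖ < R / X.size := (lt_div_iff₀ X.size_pos).2 hadm.lt_radius
  have hGL := hadm.isAnalyticGLOnProd hroot hq1 hqX hp.pos hpK hL hA.1
  refine ⟨fun x _ y hy hxy => hadm.summable_taylorTerm hroot hq1 hy hxy,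
    fun Q T => taylorSolution q H (Q * T) T, hGL, fun T hT => ?_, fun Q hQ T _ y hy hTy => ?_,
    fun _ _ _ _ => rfl, fun G hG hGq Q hQ T hT => ?_,
    fun Z hZ => ⟨fun Q hQ T _ y hy hTy => ?_, fun G hG hGq Q hQ T hT => ?_⟩⟩
  · simpa [orbitProd] using taylorSolution_pow_mul_self hroot hqX hadm.iterated hT 1
  · exact hadm.taylorSolution_mul_taylorSolution hroot hq1 hqX hp.pos hpK hL hA.1 hy hTy hQ
  · ext i j
    refine (hGL.1 i j).eq_of_forall_algebraMap hL hroot hq1 hqρ hp.pos hpK (hG i j) hT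
      (fun q' hq' => ?_) hQ
    -- On the diagonal y = T, where Y_A(T,T) = 1, the relation determines G(q',T).
    have h := hGq q' hq' T hT T hT (by simpa using hadm.radius_pos)
    rw [taylorSolution_self hadm.iterated hT, mul_one] at h
    exact congrFun (congrFun h.symm i) j
  · exact hadm.solution_mul hroot hq1 hqX hp.pos hpK hL (Z := fun x => Z x y) hy
      (fun i j => ((hZ y hy).1 i j).mem hL) (fun x hx => ((hZ y hy).2 x hx).2) hTy hQ
  · ext i j
    refine (hGL.1 i j).eq_of_forall_algebraMap hL hroot hq1 hqρ hp.pos hpK (hG i j) hT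
      (fun q' hq' => ?_) hQ
    have hTT : ‖T - T‖ < R := by simpa using hadm.radius_pos
    have hunit := ((hZ T hT).2 T hTT).1
    have h1 := hGq q' hq' T hT T hT hTT
    -- On the diagonal, both G(q',T) and Y_A(q'T,T) send Z(T,T) to Z(q'T,T); invertibility of Z(T,T)
    -- allows cancellation.
    have h2 := hadm.solution_mul hroot hq1 hqX hp.pos hpK hL (Z := fun x => Z x T) hT
      (fun i j => ((hZ T hT).1 i j).mem hL) (fun x hx => ((hZ T hT).2 x hx).2) hTT
      (Q := algebraMap K L q') (by
        rwa [← map_one (algebraMap K L), ← map_sub, norm_algebraMap'])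
    exact congrFun (congrFun (hunit.mul_left_injective (h1.symm.trans h2)) i) j
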